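/- Let $d\ge 1$ and let $w:[0,1]\to[0,\infty)$ be continuous and strictly positive on an interval $(0,c)$ for some $c\in(0,1]$. Let $\{X_t\}_{t\in\mathbb Z}$ be a strictly stationary $\mathbb R^d$-valued process with finite second moments and mean $\mu_0=\mathrm E X_t$, such that the matrix $\Sigma=\sum_{j=-\infty}^{\infty}\mathrm{cov}(X_0,X_j)$ exists and is positive definite; let $\Sigma^{1/2}$ be its symmetric positive definite square root. Let $B=(B_1,\dots,B_d)'$ be a vector of independent standard Brownian motions on $[0,1]$. Let $S_n(\cdot)$ be the linear interpolation on $[0,1]$ of $S_n(i/n)=\sum_{j=1}^i(X_j-\mu_0)$, $i=0,\dots,n$, and assume that $n^{-1/2}S_n(\cdot)$ converges in distribution to $\Sigma^{1/2}B(\cdot)$ in the space $\mathcal C_d[0,1]$ of continuous functions $[0,1]\to\mathbb R^d$ with the supremum metric. For $i=1,\dots,n$ define the forward and backward block sums $$T_i=w(i/n)\sum_{j=1}^{i}(X_j-\mu_0),\qquad T_{n+i}=w(i/n)\sum_{j=1}^{i}(X_{n-j+1}-\mu_0),$$ and let $$\tilde L_n(\mu_0)=\sup\Big\{\prod_{i=1}^{2n}p_i:\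 p_i\ge 0,\ \sum_{i=1}^{2n}p_i=1,\ \sum_{i=1}^{2n}p_iT_i=0_d\Big\},\qquad \tilde R_n(\mu_0)=(2n)^{2n}\tilde L_n(\mu_0),$$ with $\sup\emptyset=0$. Let $\tilde\lambda_{n,\mu_0}\in\mathbb R^d$ be the Lagrange multiplier, that is, the solution $\lambda$ of $\sum_{i=1}^{2n}T_i/(1+\lambda'T_i)=0_d$ with $1+\lambda'T_i>0$ for all $i$. For $t\in[0,1]$ set $f(t)=w(t)B(t)$ and $\tilde f(t)=w(t)[B(1)-B(1-t)]$; for $a$ in $$\overline K_d=\Big\{y\in\mathbb R^d:\ \min_{0\le t\le1}(1+y'f(t))\ge0,\ \min_{0\le t\le1}(1+y'\tilde f(t))\ge0\Big\}$$ set $$\tilde g_d(a)=-\int_0^1\log(1+a'f(t))\,dt-\int_0^1\log(1+a'\tilde f(t))\,dt\in(-\infty,+\infty].$$ Then, with probability tending to one as $n\to\infty$, $\tilde R_n(\mu_0)>0$ and $\tilde\lambda_{n,\mu_0}$ exists and is unique. Almost surely, $\tilde g_d$ has a unique minimizer over $\overline K_d$, which defines an $\mathbb R^d$-valued random vector $\tilde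 Y_d$; almost surely $-\tilde g_d(\tilde Y_d)\in(0,\infty)$; and, as $n\to\infty$ (with arbitrary fixed values, here $0$, given to $\tilde\lambda_{n,\mu_0}$ and to $\log\tilde R_n(\mu_0)$ where they are undefined), $$n^{1/2}\,\Sigma^{1/2}\tilde\lambda_{n,\mu_0}\ \stackrel{d}{\longrightarrow}\ \tilde Y_d,\qquad -\frac1n\log\tilde R_n(\mu_0)\ \stackrel{d}{\longrightarrow}\ -\tilde g_d(\tilde Y_d).$$ -/

import Mathlib

open MeasureTheory ProbabilityTheory Filter Topology
open scoped unitInterval ENNReal MatrixOrder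

noncomputable section

namespace EBEL

/-- `ℝ^d` with its Euclidean norm. -/
abbrev E (d : ℕ) : Type := EuclideanSpace ℝ (Fin d)

/-- The path space `C_d[0,1]` (with the supremum metric) carries its Borel σ-algebra. -/
instance instMeasurableSpacePath (d : ℕ) : MeasurableSpace C(I, E d) := borel _

instance instBorelSpacePath (d : ℕ) : BorelSpace C(I, E d) := ⟨rfl⟩

/-! ### Brownian motion on `[0,1]` -/

/-- Standard real Brownian motion on `[0,1]` (path continuity is built into the path space where
this is used). -/
structure IsStdBrownian {Ω : Type*} [MeasurableSpace Ω] (W : I → Ω → ℝ) (P : Measure Ω) :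
    Prop where
  zero : ∀ᵐ ω ∂P, W 0 ω = 0
  indep : HasIndepIncrements W P
  law : ∀ s t : I, s ≤ t →
    HasLaw (fun ω => W t ω - W s ω) (gaussianReal 0 (Real.toNNReal ((t : ℝ) - s))) P

/-- A `C_d[0,1]`-valued random variable whose `d` coordinates are i.i.d. standard Brownian
motions on `[0,1]`. -/
structure IsStdBrownianVector {d : ℕ} {Ω : Type*} [MeasurableSpace Ω]
    (B : Ω → C(I, E d)) (P : Measure Ω) : Prop where
  measurable : Measurable B
  coord : ∀ i : Fin d, IsStdBrownian (fun t ω => B ω t i) P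
  indep : iIndepFun (fun (i : Fin d) (ω : Ω) (t : I) => B ω t i) P

/-! ### The weight function and the time series -/

/-- The weight function is nonnegative and continuous on `[0,1]`, and strictly positive on some
interval `(0,c)` with `0 < c ≤ 1`. Only its values on `[0,1]` are ever used. -/
structure IsWeight (w : ℝ → ℝ) : Prop where
  continuousOn : ContinuousOn w (Set.Icc 0 1)
  nonneg : ∀ t ∈ Set.Icc (0 : ℝ) 1, 0 ≤ w t
  pos : ∃ c ∈ Set.Ioc (0 : ℝ) 1, ∀ t ∈ Set.Ioo 0 c, 0 < w t

/-- Strict stationarity of a process indexed by `ℤ`: all time shifts have the same law. -/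
structure IsStrictlyStationary {d : ℕ} {Ω : Type*} [MeasurableSpace Ω]
    (X : ℤ → Ω → E d) (P : Measure Ω) : Prop where
  measurable : ∀ t, Measurable (X t)
  shift : ∀ k : ℤ, IdentDistrib (fun ω (t : ℤ) => X t ω) (fun ω (t : ℤ) => X (t + k) ω) P P

/-- `S = ∑_{j ∈ ℤ} cov(X_0, X_j)`, entry by entry, the two-sided series being the limit of its
symmetric partial sums (which covers absolutely convergent series as well). -/
def IsLongRunCov {d : ℕ} {Ω : Type*} [MeasurableSpace Ω]
    (S : Matrix (Fin d) (Fin d) ℝ) (X : ℤ → Ω → E d) (P : Measure Ω) : Prop :=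
  ∀ i k : Fin d, Tendsto
    (fun m : ℕ => ∑ j ∈ Finset.Icc (-(m : ℤ)) (m : ℤ),
      covariance (fun ω => X 0 ω i) (fun ω => X j ω k) P)
    atTop (𝓝 (S i k))

/-- The linear interpolation on `[0,1]` of `S_n(i/n) = ∑_{j=1}^i (x_j - μ)`, `i = 0,…,n`. -/
def partialSumPath {d : ℕ} (x : ℤ → E d) (μ : E d) (n : ℕ) : C(I, E d) where
  toFun t := ∑ j ∈ Finset.range n,
    (max 0 (min 1 ((n : ℝ) * (t : ℝ) - (j : ℝ)))) • (x ((j : ℤ) + 1) - μ)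
  continuous_toFun := by fun_prop

/-- On `[k/n, (k+1)/n]` the path is the partial sum of the first `k` terms plus the linear
interpolation of the next one. -/
theorem partialSumPath_apply {d : ℕ} (x : ℤ → E d) (μ : E d) {n k : ℕ} (hk : k < n) (t : I)
    (h1 : (k : ℝ) ≤ n * (t : ℝ)) (h2 : (n : ℝ) * (t : ℝ) ≤ k + 1) :
    partialSumPath x μ n t = ∑ j ∈ Finset.range k, (x ((j : ℤ) + 1) - μ) +
      ((n : ℝ) * (t : ℝ) - k) • (x ((k : ℤ) + 1) - μ) := by
  obtain ⟨m, rfl⟩ := Nat.exists_eq_add_of_lt hk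
  change ∑ j ∈ Finset.range (k + m + 1), _ = _
  rw [show k + m + 1 = (k + 1) + m by ring, Finset.sum_range_add, Finset.sum_range_succ]
  have e1 : ∀ j ∈ Finset.range k,
      (max 0 (min 1 (((k + m + 1 : ℕ) : ℝ) * (t : ℝ) - (j : ℝ)))) • (x ((j : ℤ) + 1) - μ)
        = x ((j : ℤ) + 1) - μ := by
    intro j hj
    have hj' : (j : ℝ) + 1 ≤ k := by exact_mod_cast Finset.mem_range.1 hj
    rw [min_eq_left (by linarith), max_eq_right zero_le_one, one_smul]
  have e2 : ∀ j ∈ Finset.range m,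
      (max 0 (min 1 (((k + m + 1 : ℕ) : ℝ) * (t : ℝ) - ((k + 1 + j : ℕ) : ℝ)))) •
        (x (((k + 1 + j : ℕ) : ℤ) + 1) - μ) = 0 := by
    intro j _
    have : (((k + m + 1 : ℕ) : ℝ) * (t : ℝ) - ((k + 1 + j : ℕ) : ℝ)) ≤ 0 := by
      have h3 : ((k + 1 + j : ℕ) : ℝ) = k + 1 + j := by push_cast; ring
      have h4 : (0 : ℝ) ≤ j := Nat.cast_nonneg j
      rw [h3]; linarith
    rw [max_eq_left ((min_le_right _ _).trans this), zero_smul]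
  rw [show k + 1 + m = k + m + 1 by ring, Finset.sum_congr rfl e1, Finset.sum_congr rfl e2,
    min_eq_right (by linarith), max_eq_right (by linarith)]
  simp

/-- The linear map of `ℝ^d` given by the symmetric positive semidefinite square root of `S`. -/
def sqrtMap {d : ℕ} (S : Matrix (Fin d) (Fin d) ℝ) : E d →L[ℝ] E d :=
  Matrix.toEuclideanCLM (𝕜 := ℝ) (CFC.sqrt S)

/-- The path `t ↦ S^{1/2} b(t)`. -/
def sqrtPath {d : ℕ} (S : Matrix (Fin d) (Fin d) ℝ) (b : C(I, E d)) : C(I, E d) where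
  toFun t := sqrtMap S (b t)
  continuous_toFun := by fun_prop

/-! ### Empirical likelihood with forward and backward expansive blocks -/

/-- The `2n` weighted centred block sums. The index `Sum.inl i` (with `i = 0,…,n-1`) is the forward
block `w((i+1)/n) ∑_{j=1}^{i+1} (x_j - μ)`, and `Sum.inr i` the backward block
`w((i+1)/n) ∑_{j=1}^{i+1} (x_{n-j+1} - μ)`. -/
def blockSum {d : ℕ} (w : ℝ → ℝ) (x : ℤ → E d) (μ : E d) (n : ℕ) : Fin n ⊕ Fin n → E d
  | Sum.inl i => w (((i : ℝ) + 1) / n) •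
      ∑ j ∈ Finset.Icc 1 ((i : ℕ) + 1), (x (j : ℤ) - μ)
  | Sum.inr i => w (((i : ℝ) + 1) / n) •
      ∑ j ∈ Finset.Icc 1 ((i : ℕ) + 1), (x ((n : ℤ) - (j : ℤ) + 1) - μ)

/-- The empirical likelihood `sup {∏ p_i : p_i ≥ 0, ∑ p_i = 1, ∑ p_i T_i = 0}`
(equal to `0` if there is no such `p`; the set is bounded by `1`). -/
def elikelihood {d : ℕ} {ι : Type*} [Fintype ι] (T : ι → E d) : ℝ :=
  sSup {r : ℝ | ∃ p : ι → ℝ, (∀ i, 0 ≤ p i) ∧ ∑ i, p i = 1 ∧ ∑ i, p i • T i = 0 ∧ r = ∏ i, p i}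

/-- The empirical likelihood divided by its unconstrained maximum `N^{-N}`, where `N` is the number
of the `T_i`. -/
def elRatio {d : ℕ} {ι : Type*} [Fintype ι] (T : ι → E d) : ℝ :=
  (Fintype.card ι : ℝ) ^ Fintype.card ι * elikelihood T

/-- `l` is a Lagrange multiplier for `T`: all the probabilities `1 / (N (1 + l'T_i))` are positive,
and `∑ T_i / (1 + l'T_i) = 0`. -/
def IsMultiplier {d : ℕ} {ι : Type*} [Fintype ι] (T : ι → E d) (l : E d) : Prop :=
  (∀ i, 0 < 1 + inner ℝ l (T i)) ∧ ∑ i, (1 + inner ℝ l (T i))⁻¹ • T i = 0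

open Classical in
/-- The Lagrange multiplier for `T`, where it exists and is unique (and `0` elsewhere). -/
def multiplier {d : ℕ} {ι : Type*} [Fintype ι] (T : ι → E d) : E d :=
  if h : ∃! l, IsMultiplier T l then h.choose else 0

/-! ### The limit -/

/-- `f(t) = w(t) b(t)`. -/
def limitFwd {d : ℕ} (w : ℝ → ℝ) (b : C(I, E d)) (t : I) : E d := w t • b t

/-- `f̃(t) = w(t) [b(1) - b(1-t)]`. -/
def limitBwd {d : ℕ} (w : ℝ → ℝ) (b : C(I, E d)) (t : I) : E d :=
  w t • (b 1 - b (unitInterval.symm t))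

/-- `-∫_0^1 log h(t) dt` as an extended real number, for `h ≥ 0`, with `log 0 = -∞`: the integral
of the positive part of `-log h` minus the integral of its negative part. -/
def negLogIntegral (h : I → ℝ) : EReal :=
  ((∫⁻ t, (-ENNReal.log (ENNReal.ofReal (h t))).toENNReal : ℝ≥0∞) : EReal) -
    ((∫⁻ t, (ENNReal.log (ENNReal.ofReal (h t))).toENNReal : ℝ≥0∞) : EReal)

/-- The limiting objective `g̃_d(a) = -∫ log(1 + a'f) - ∫ log(1 + a'f̃)`. -/
def limitObj {d : ℕ} (w : ℝ → ℝ) (b : C(I, E d)) (a : E d) : EReal :=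
  negLogIntegral (fun t => 1 + inner ℝ a (limitFwd w b t)) +
    negLogIntegral (fun t => 1 + inner ℝ a (limitBwd w b t))

/-- The set of all `y` with `1 + y'f ≥ 0` and `1 + y'f̃ ≥ 0` on `[0,1]`. -/
def limitDomain {d : ℕ} (w : ℝ → ℝ) (b : C(I, E d)) : Set (E d) :=
  {y | (∀ t : I, 0 ≤ 1 + inner ℝ y (limitFwd w b t)) ∧
    ∀ t : I, 0 ≤ 1 + inner ℝ y (limitBwd w b t)}

/-- `y` is the unique minimizer of the limiting objective over its domain. -/
def IsUniqueMinimizer {d : ℕ} (w : ℝ → ℝ) (b : C(I, E d)) (y : E d) : Prop :=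
  y ∈ limitDomain w b ∧ ∀ a ∈ limitDomain w b, a ≠ y → limitObj w b y < limitObj w b a

end EBEL

end

namespace EBEL

/-! ### Finite empirical likelihood -/

section Finite

variable {d : ℕ} {ι : Type*} [Fintype ι] {T : ι → E d} {l a : E d}

/-! The theorem is an instance of the continuous mapping theorem with maps depending on `n`.
Standardize the partial sum path by `n^{-1/2} Σ^{-1/2}`; the resulting path converges in law to `B`,
and the block sums are the image under `n^{1/2} Σ^{1/2}` of the weighted blocks of that path
(`blockSum_eq`). A linear bijection leaves the likelihood ratio unchanged and moves by
self-adjointness onto the multiplier, so `n^{1/2} Σ^{1/2} λ` is exactly the multiplier of the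
standardized blocks. By `tendstoInDistribution_map` it remains to prove a deterministic statement:
for almost every Brownian path `b`, multipliers and log ratios converge along all paths tending to
`b` as the mesh tends to zero.

The deterministic input is that `w b` meets every open half-space. Compactness of the unit sphere
makes this uniform and stable (`eventually_halfspace`), so multipliers eventually exist, are unique
and stay bounded. A multiplier maximizes the concave sum of logarithms. At a limit point `z` the
sums are bounded above by truncating the logarithm from below; competitors `a` are shrunk to `s •
a`, `s < 1`, where all slacks are bounded away from zero. Riemann sums then converge, and letting
the truncation vanish and `s → 1` shows that `z` minimizes the limiting objective
(`isMin_of_tendsto`). Strict concavity gives uniqueness, hence convergence (`tendsto_multiplier`,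
`tendsto_gridVal`). The constant sequence of paths yields existence of the minimizer.

Two facts about Brownian motion remain. It enters every open orthant at arbitrarily small times, by
both Borel–Cantelli lemmas (`ae_exists_orthant`), which gives the half-space condition. The
directional derivative of the objective at `0` is a weighted Brownian integral without atom at `0`
(`IsStdBrownian.ae_integral_ne_zero`), so `0` is not the minimizer and the minimum is strictly
negative. -/

/-- Bound each logarithm by its tangent at `1 + l'T_i`; the linear terms cancel by the multiplier
equation. -/
theorem IsMultiplier.sum_log_le (hl : IsMultiplier T l) (ha : ∀ i, 0 < 1 + inner ℝ a (T i)) :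
    ∑ i, Real.log (1 + inner ℝ a (T i)) ≤ ∑ i, Real.log (1 + inner ℝ l (T i)) := by
  have h0 : ∑ i, (1 + inner ℝ l (T i))⁻¹ * inner ℝ (a - l) (T i) = 0 := by
    have := congrArg (inner ℝ (a - l)) hl.2
    simpa [inner_sum, inner_smul_right] using this
  rw [← sub_nonpos, ← Finset.sum_sub_distrib, ← h0]
  refine Finset.sum_le_sum fun i _ => ?_
  have hp := hl.1 i
  rw [← Real.log_div (ha i).ne' hp.ne']
  refine (Real.log_le_sub_one_of_pos (div_pos (ha i) hp)).trans_eq ?_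
  rw [inner_sub_left]
  field_simp
  ring

/-- Testing both multiplier equations against `l - a` and subtracting leaves a vanishing sum of
nonnegative squares. The multipliers themselves may still differ by a vector orthogonal to all `T
i`. -/
theorem IsMultiplier.inner_eq (hl : IsMultiplier T l) (ha : IsMultiplier T a) (i : ι) :
    inner ℝ l (T i) = inner ℝ a (T i) := by
  have e1 : ∑ i, (1 + inner ℝ l (T i))⁻¹ * inner ℝ (l - a) (T i) = 0 := by
    have := congrArg (inner ℝ (l - a)) hl.2
    simpa [inner_sum, inner_smul_right] using this
  have e2 : ∑ i, (1 + inner ℝ a (T i))⁻¹ * inner ℝ (l - a) (T i) = 0 := by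
    have := congrArg (inner ℝ (l - a)) ha.2
    simpa [inner_sum, inner_smul_right] using this
  have key : ∀ i, (1 + inner ℝ a (T i))⁻¹ * inner ℝ (l - a) (T i)
      - (1 + inner ℝ l (T i))⁻¹ * inner ℝ (l - a) (T i)
      = (inner ℝ l (T i) - inner ℝ a (T i)) ^ 2
        / ((1 + inner ℝ a (T i)) * (1 + inner ℝ l (T i))) := by
    intro i
    have h1 := (hl.1 i).ne'
    have h2 := (ha.1 i).ne'
    rw [inner_sub_left]
    field_simp
    ring
  have h0 : ∑ i, (inner ℝ l (T i) - inner ℝ a (T i)) ^ 2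
        / ((1 + inner ℝ a (T i)) * (1 + inner ℝ l (T i))) = 0 := by
    rw [← Finset.sum_congr rfl (fun i _ => key i), Finset.sum_sub_distrib, e1, e2, sub_zero]
  rw [Finset.sum_eq_zero_iff_of_nonneg
    (fun i _ => div_nonneg (sq_nonneg _) (mul_pos (ha.1 i) (hl.1 i)).le)] at h0
  have h3 := h0 i (Finset.mem_univ i)
  rw [div_eq_zero_iff, or_iff_left (mul_pos (ha.1 i) (hl.1 i)).ne', sq_eq_zero_iff] at h3
  linarith

/-- At a multiplier the empirical likelihood ratio is the product of the `(1 + l'T_i)⁻¹`. -/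
theorem IsMultiplier.elRatio_eq [Nonempty ι] (hl : IsMultiplier T l) :
    elRatio T = ∏ i, (1 + inner ℝ l (T i))⁻¹ := by
  set N : ℝ := (Fintype.card ι : ℝ) with hN
  have hN0 : 0 < N := by rw [hN]; exact_mod_cast Fintype.card_pos
  set p : ι → ℝ := fun i => N⁻¹ * (1 + inner ℝ l (T i))⁻¹ with hp
  have hp0 : ∀ i, 0 < p i := fun i => mul_pos (inv_pos.2 hN0) (inv_pos.2 (hl.1 i))
  have hpT : ∑ i, p i • T i = 0 := by
    simp only [hp, mul_smul, ← Finset.smul_sum, hl.2, smul_zero]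
  have hdot : ∀ q : ι → ℝ, ∑ i, q i • T i = 0 → ∑ i, q i * inner ℝ l (T i) = 0 := by
    intro q hq
    have := congrArg (inner ℝ l) hq
    simpa [inner_sum, inner_smul_right] using this
  have hp1 : ∑ i, p i = 1 := by
    have h1 : ∑ i, p i * (1 + inner ℝ l (T i)) = 1 := by
      have : ∀ i, p i * (1 + inner ℝ l (T i)) = N⁻¹ := fun i => by
        simp only [hp]; rw [mul_assoc, inv_mul_cancel₀ (hl.1 i).ne', mul_one]
      rw [Finset.sum_congr rfl fun i _ => this i, Finset.sum_const, Finset.card_univ,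
        nsmul_eq_mul, ← hN, mul_inv_cancel₀ hN0.ne']
    simpa [mul_add, Finset.sum_add_distrib, hdot p hpT] using h1
  have hprod : ∏ i, p i = (N ^ Fintype.card ι)⁻¹ * ∏ i, (1 + inner ℝ l (T i))⁻¹ := by
    simp only [hp, Finset.prod_mul_distrib, Finset.prod_const, Finset.card_univ, inv_pow]
  have hub : ∀ q : ι → ℝ, (∀ i, 0 ≤ q i) → ∑ i, q i = 1 → ∑ i, q i • T i = 0 →
      ∏ i, q i ≤ ∏ i, p i := by
    intro q q0 q1 qT
    have hz0 : ∀ i, 0 ≤ q i / p i := fun i => div_nonneg (q0 i) (hp0 i).le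
    have hs : ∑ i, q i / p i = N := by
      have : ∀ i, q i / p i = N * (q i + q i * inner ℝ l (T i)) := fun i => by
        simp only [hp]
        have := (hl.1 i).ne'
        field_simp
      rw [Finset.sum_congr rfl fun i _ => this i, ← Finset.mul_sum, Finset.sum_add_distrib, q1,
        hdot q qT, add_zero, mul_one]
    -- The arithmetic-geometric mean inequality: the ratios sum to `N`, and multiplying `z ≤ exp (z
    -- - 1)` over them gives `exp 0`.
    have h1 : ∏ i, (q i / p i) ≤ 1 := by
      calc ∏ i, (q i / p i) ≤ ∏ i, Real.exp (q i / p i - 1) :=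
            Finset.prod_le_prod (fun i _ => hz0 i)
              fun i _ => by linarith [Real.add_one_le_exp (q i / p i - 1)]
        _ = 1 := by
            rw [← Real.exp_sum, Finset.sum_sub_distrib, hs]
            simp [hN]
    rw [Finset.prod_div_distrib, div_le_one (Finset.prod_pos fun i _ => hp0 i)] at h1
    exact h1
  have hlik : elikelihood T = ∏ i, p i := by
    refine IsGreatest.csSup_eq ⟨⟨p, fun i => (hp0 i).le, hp1, hpT, rfl⟩, ?_⟩
    rintro r ⟨q, q0, q1, qT, rfl⟩
    exact hub q q0 q1 qT
  rw [elRatio, hlik, hprod, ← mul_assoc, mul_inv_cancel₀ (pow_ne_zero _ hN0.ne'), one_mul]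

theorem IsMultiplier.elRatio_pos [Nonempty ι] (hl : IsMultiplier T l) : 0 < elRatio T := by
  rw [hl.elRatio_eq]
  exact Finset.prod_pos fun i _ => inv_pos.2 (hl.1 i)

theorem IsMultiplier.log_elRatio_eq [Nonempty ι] (hl : IsMultiplier T l) :
    Real.log (elRatio T) = -∑ i, Real.log (1 + inner ℝ l (T i)) := by
  rw [hl.elRatio_eq, Real.log_prod fun i _ => (inv_pos.2 (hl.1 i)).ne']
  simp

/-- If every open half-space `{x | u'x < -m}` with `‖u‖ = 1` meets the family, the vectors in its
polar set have norm at most `1/m`. -/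
theorem norm_le_of_halfspace {κ : Type*} {T : κ → E d} {m : ℝ}
    (h : ∀ u : E d, ‖u‖ = 1 → ∃ i, inner ℝ u (T i) < -m)
    (ha : ∀ i, 0 ≤ 1 + inner ℝ a (T i)) : m * ‖a‖ ≤ 1 := by
  rcases eq_or_ne a 0 with rfl | h0
  · simp
  have hn : 0 < ‖a‖ := norm_pos_iff.2 h0
  obtain ⟨i, hi⟩ := h (‖a‖⁻¹ • a) (by rw [norm_smul, norm_inv, norm_norm, inv_mul_cancel₀ hn.ne'])
  rw [real_inner_smul_left] at hi
  have h1 := ha i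
  have h2 : inner ℝ a (T i) = ‖a‖ * (‖a‖⁻¹ * inner ℝ a (T i)) := by field_simp
  have h3 := mul_lt_mul_of_pos_left hi hn
  linarith

/-- The half-space condition makes the polar set compact. The product of the slacks, unlike the sum
of their logarithms, is continuous up to the boundary, so it has a maximizer; its value at `0` is
`1`, hence the maximizer has positive slacks and is a critical point. Two multipliers differ by a
vector orthogonal to all `T i`, which the condition forces to vanish. -/
theorem existsUnique_isMultiplier {m : ℝ} (hm : 0 < m)
    (h : ∀ u : E d, ‖u‖ = 1 → ∃ i, inner ℝ u (T i) < -m) : ∃! l, IsMultiplier T l := by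
  set K : Set (E d) := {l | ∀ i, 0 ≤ 1 + inner ℝ l (T i)} with hK
  have hKc : IsCompact K := by
    refine Metric.isCompact_of_isClosed_isBounded ?_ ?_
    · simp only [hK, Set.ofPred_forall]
      exact isClosed_iInter fun i => isClosed_le continuous_const (by fun_prop)
    · refine (Metric.isBounded_closedBall (x := (0 : E d)) (r := 1 / m)).subset fun l hl => ?_
      rw [mem_closedBall_zero_iff, le_div_iff₀ hm, mul_comm]
      exact norm_le_of_halfspace h hl
  have h0K : (0 : E d) ∈ K := fun i => by simp
  obtain ⟨l, hlK, hlmax⟩ := hKc.exists_isMaxOn ⟨0, h0K⟩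
    (f := fun l => ∏ i, (1 + inner ℝ l (T i))) (by fun_prop)
  have hprod : 0 < ∏ i, (1 + inner ℝ l (T i)) := by
    have : ∏ i, (1 + inner ℝ (0 : E d) (T i)) ≤ ∏ i, (1 + inner ℝ l (T i)) := hlmax h0K
    simp only [inner_zero_left, add_zero, Finset.prod_const_one] at this
    linarith
  have hpos : ∀ i, 0 < 1 + inner ℝ l (T i) := fun i =>
    lt_of_le_of_ne (hlK i) fun h => hprod.ne' (Finset.prod_eq_zero (Finset.mem_univ i) h.symm)
  have hmul : IsMultiplier T l := by
    refine ⟨hpos, ext_inner_left ℝ fun u => ?_⟩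
    have hder : HasDerivAt (fun s : ℝ => ∑ i, Real.log (1 + inner ℝ (l + s • u) (T i)))
        (∑ i, inner ℝ u (T i) / (1 + inner ℝ l (T i))) 0 := by
      refine HasDerivAt.fun_sum fun i _ => ?_
      have h1 : HasDerivAt (fun s : ℝ => 1 + inner ℝ (l + s • u) (T i)) (inner ℝ u (T i)) 0 := by
        have : (fun s : ℝ => 1 + inner ℝ (l + s • u) (T i))
            = fun s : ℝ => (1 + inner ℝ l (T i)) + s * inner ℝ u (T i) := by
          funext s; rw [inner_add_left, real_inner_smul_left]; ring
        rw [this]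
        simpa using ((hasDerivAt_id (0 : ℝ)).mul_const (inner ℝ u (T i))).const_add
          (1 + inner ℝ l (T i))
      simpa using h1.log (by simpa using (hpos i).ne')
    have hloc : IsLocalMax (fun s : ℝ => ∑ i, Real.log (1 + inner ℝ (l + s • u) (T i))) 0 := by
      have hev : ∀ᶠ s : ℝ in 𝓝 0, ∀ i, 0 < 1 + inner ℝ (l + s • u) (T i) := by
        rw [eventually_all]
        intro i
        have hc : Continuous fun s : ℝ => 1 + inner ℝ (l + s • u) (T i) := by fun_prop
        exact hc.continuousAt.eventually (lt_mem_nhds (by simpa using hpos i))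
      filter_upwards [hev] with s hs
      have h1 : ∏ i, (1 + inner ℝ (l + s • u) (T i)) ≤ ∏ i, (1 + inner ℝ l (T i)) :=
        hlmax (show l + s • u ∈ K from fun i => (hs i).le)
      have h2 := Real.log_le_log (Finset.prod_pos fun i _ => hs i) h1
      rw [Real.log_prod fun i _ => (hs i).ne', Real.log_prod fun i _ => (hpos i).ne'] at h2
      simpa using h2
    have := hloc.hasDerivAt_eq_zero hder
    simpa [inner_sum, inner_smul_right, div_eq_inv_mul] using this
  refine ⟨l, hmul, fun a ha => ?_⟩
  by_contra hne
  have hn : 0 < ‖a - l‖ := norm_pos_iff.2 (sub_ne_zero.2 hne)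
  obtain ⟨i, hi⟩ := h (‖a - l‖⁻¹ • (a - l))
    (by rw [norm_smul, norm_inv, norm_norm, inv_mul_cancel₀ hn.ne'])
  rw [real_inner_smul_left, inner_sub_left, ha.inner_eq hmul i] at hi
  simp at hi
  linarith

theorem isMultiplier_multiplier (h : ∃! l, IsMultiplier T l) : IsMultiplier T (multiplier T) := by
  rw [multiplier, dif_pos h]
  exact h.choose_spec.1

theorem multiplier_eq (h : ∃! l, IsMultiplier T l) (hl : IsMultiplier T l) : multiplier T = l :=
  h.unique (isMultiplier_multiplier h) hl

/-! ### Linear changes of variables -/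

/-- Self-adjointness moves `L` from the vectors to the multiplier. This is how `n^{1/2} Σ^{1/2}`
comes to stand in front of the multiplier in the limit theorem. -/
theorem isMultiplier_comp_iff {L : E d →L[ℝ] E d} (hs : ∀ x y, inner ℝ (L x) y = inner ℝ x (L y))
    (hb : Function.Bijective L) : IsMultiplier (fun i => L (T i)) l ↔ IsMultiplier T (L l) := by
  simp only [IsMultiplier, hs, ← map_smul, ← map_sum, map_eq_zero_iff L hb.1]

theorem existsUnique_isMultiplier_comp_iff {L : E d →L[ℝ] E d}
    (hs : ∀ x y, inner ℝ (L x) y = inner ℝ x (L y)) (hb : Function.Bijective L) :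
    (∃! l, IsMultiplier (fun i => L (T i)) l) ↔ ∃! l, IsMultiplier T l := by
  simp only [isMultiplier_comp_iff hs hb]
  exact (hb.existsUnique_iff).symm

theorem multiplier_comp {L : E d →L[ℝ] E d} (hs : ∀ x y, inner ℝ (L x) y = inner ℝ x (L y))
    (hb : Function.Bijective L) : L (multiplier fun i => L (T i)) = multiplier T := by
  by_cases h : ∃! l, IsMultiplier T l
  · exact (multiplier_eq h ((isMultiplier_comp_iff hs hb).1
      (isMultiplier_multiplier ((existsUnique_isMultiplier_comp_iff hs hb).2 h)))).symm
  -- Here both multipliers take the default value `0`, which `L` preserves.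
  · have h' : ¬ ∃! l, IsMultiplier (fun i => L (T i)) l := fun h' =>
      h ((existsUnique_isMultiplier_comp_iff hs hb).1 h')
    rw [multiplier, multiplier, dif_neg h, dif_neg h', map_zero]

theorem elRatio_comp {L : E d →L[ℝ] E d} (hi : Function.Injective L) :
    elRatio (fun i => L (T i)) = elRatio T := by
  simp only [elRatio, elikelihood, ← map_smul, ← map_sum, map_eq_zero_iff L hi]

/-! ### Measurability -/

/-- Uniqueness fails exactly when some unit vector is orthogonal to every `T i`. In this form the
exceptional set is the projection of a closed set along a compact sphere, hence closed. -/
theorem existsUnique_isMultiplier_iff : (∃! l, IsMultiplier T l) ↔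
    ∃ l, IsMultiplier T l ∧ ¬ ∃ u : Metric.sphere (0 : E d) 1, ∀ i, inner ℝ (u : E d) (T i) = 0 :=
      by
  constructor
  · rintro ⟨l, hl, huniq⟩
    refine ⟨l, hl, ?_⟩
    rintro ⟨u, hu⟩
    have h1 : IsMultiplier T (l + (u : E d)) := by
      simpa [IsMultiplier, inner_add_left, hu] using hl
    have h2 : (u : E d) = 0 := by simpa using huniq _ h1
    have h3 := u.2
    rw [h2] at h3
    simp at h3
  · rintro ⟨l, hl, hu⟩
    refine ⟨l, hl, fun a ha => ?_⟩
    by_contra hne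
    have hn : 0 < ‖a - l‖ := norm_pos_iff.2 (sub_ne_zero.2 hne)
    refine hu ⟨⟨‖a - l‖⁻¹ • (a - l), ?_⟩, fun i => ?_⟩
    · rw [mem_sphere_zero_iff_norm, norm_smul, norm_inv, norm_norm, inv_mul_cancel₀ hn.ne']
    · rw [real_inner_smul_left, inner_sub_left, ha.inner_eq hl i, sub_self, mul_zero]

/-- The graph is Borel and projects injectively, so the Lusin–Souslin theorem makes the relevant
images Borel. -/
theorem measurable_multiplier : Measurable (multiplier : (ι → E d) → E d) := by
  set G : Set ((ι → E d) × E d) := {q | IsMultiplier q.1 q.2 ∧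
    ¬ ∃ u : Metric.sphere (0 : E d) 1, ∀ i, inner ℝ (u : E d) (q.1 i) = 0} with hG
  have hspan : MeasurableSet {T : ι → E d |
      ∃ u : Metric.sphere (0 : E d) 1, ∀ i, inner ℝ (u : E d) (T i) = 0} := by
    have hc : IsClosed {q : Metric.sphere (0 : E d) 1 × (ι → E d) |
        ∀ i, inner ℝ (q.1 : E d) (q.2 i) = 0} := by
      simp only [Set.ofPred_forall]
      exact isClosed_iInter fun i => isClosed_eq (by fun_prop) continuous_const
    convert (isClosedMap_snd_of_compactSpace _ hc).measurableSet using 1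
    ext T
    simp
  have hGm : MeasurableSet G := by
    have h1 : ∀ i : ι, Measurable fun q : (ι → E d) × E d => 1 + inner ℝ q.2 (q.1 i) := fun i =>
      Continuous.measurable (by fun_prop)
    have h2 : MeasurableSet {q : (ι → E d) × E d | IsMultiplier q.1 q.2} := by
      simp only [IsMultiplier, Set.ofPred_and, Set.ofPred_forall]
      refine (MeasurableSet.iInter fun i => measurableSet_lt measurable_const (h1 i)).inter ?_
      refine measurableSet_eq_fun (Finset.measurable_sum _ fun i _ => ?_) measurable_const
      exact (h1 i).inv.smul ((measurable_pi_apply i).comp measurable_fst)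
    exact h2.inter (measurable_fst hspan.compl)
  have hex : ∀ T : ι → E d, (∃! l, IsMultiplier T l) ↔ T ∈ Prod.fst '' G := fun T => by
    rw [existsUnique_isMultiplier_iff]; simp [hG]
  have hinj : Set.InjOn Prod.fst G := by
    rintro ⟨T, l⟩ h ⟨T', a⟩ h' (rfl : T = T')
    have := (hex T).2 ⟨_, h, rfl⟩
    exact Prod.ext rfl (this.unique h.1 h'.1)
  intro A hA
  have hA1 : MeasurableSet (Prod.fst '' (G ∩ Prod.snd ⁻¹' A)) :=
    (hGm.inter (measurable_snd hA)).image_of_measurable_injOn measurable_fst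
      (hinj.mono Set.inter_subset_left)
  have hG1 : MeasurableSet (Prod.fst '' G) :=
    hGm.image_of_measurable_injOn measurable_fst hinj
  have : multiplier ⁻¹' A = Prod.fst '' (G ∩ Prod.snd ⁻¹' A) ∪
      ((Prod.fst '' G)ᶜ ∩ {_T : ι → E d | (0 : E d) ∈ A}) := by
    ext T
    by_cases h : ∃! l, IsMultiplier T l
    · have h1 := (hex T).1 h
      obtain ⟨⟨T', l⟩, hl, rfl⟩ := id h1
      have h2 : multiplier T' = l := multiplier_eq h hl.1
      simp only [Set.mem_preimage, Set.mem_union, Set.mem_inter_iff, Set.mem_compl_iff, h1,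
        not_true_eq_false, false_and, or_false, h2]
      constructor
      · exact fun hlA => ⟨_, ⟨hl, hlA⟩, rfl⟩
      · rintro ⟨⟨T'', l'⟩, ⟨hl', hlA'⟩, (rfl : T'' = T')⟩
        rw [show l = l' from h.unique hl.1 hl'.1]
        exact hlA'
    · have h1 : T ∉ Prod.fst '' G := fun h1 => h ((hex T).2 h1)
      have h2 : T ∉ Prod.fst '' (G ∩ Prod.snd ⁻¹' A) := fun h2 =>
        h1 (Set.image_mono Set.inter_subset_left h2)
      simp [Set.mem_preimage, h1, h2, multiplier, dif_neg h]
  rw [this]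
  exact hA1.union (hG1.compl.inter (MeasurableSet.const _))

theorem measurable_elRatio : Measurable (elRatio : (ι → E d) → ℝ) := by
  refine Measurable.const_mul (measurable_of_Ici fun r => ?_) _
  have hbdd : ∀ T : ι → E d, BddAbove {r : ℝ | ∃ p : ι → ℝ, (∀ i, 0 ≤ p i) ∧ ∑ i, p i = 1 ∧
      ∑ i, p i • T i = 0 ∧ r = ∏ i, p i} := by
    rintro T
    refine ⟨1, ?_⟩
    rintro _ ⟨p, p0, p1, -, rfl⟩
    refine Finset.prod_le_one (fun i _ => p0 i) fun i _ => ?_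
    rw [← p1]
    exact Finset.single_le_sum (fun j _ => p0 j) (Finset.mem_univ i)
  rcases le_or_gt r 0 with hr | hr
  · convert MeasurableSet.univ
    refine Set.eq_univ_of_forall fun T => hr.trans (Real.sSup_nonneg ?_)
    rintro _ ⟨p, p0, -, -, rfl⟩
    exact Finset.prod_nonneg fun i _ => p0 i
  -- For `r > 0` the default `sSup ∅ = 0` plays no role and the supremum is attained, so the
  -- superlevel set is the projection of a closed set along the compact simplex.
  · have hc : IsClosed {q : stdSimplex ℝ ι × (ι → E d) |
        ∑ i, q.1.1 i • q.2 i = 0 ∧ r ≤ ∏ i, q.1.1 i} := by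
      have hq : ∀ i, Continuous fun q : stdSimplex ℝ ι × (ι → E d) => q.1.1 i := fun i =>
        (continuous_apply i).comp (continuous_subtype_val.comp continuous_fst)
      refine IsClosed.inter (isClosed_eq
        (continuous_finsetSum _ fun i _ => (hq i).smul (by fun_prop)) continuous_const)
        (isClosed_le continuous_const (continuous_finsetProd _ fun i _ => hq i))
    have : CompactSpace (stdSimplex ℝ ι) :=
      isCompact_iff_compactSpace.1 (isCompact_stdSimplex ℝ ι)
    convert (isClosedMap_snd_of_compactSpace _ hc).measurableSet using 1
    ext T
    simp only [Set.mem_preimage, Set.mem_Ici, Set.mem_image, Set.mem_ofPred_eq, Prod.exists,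
      exists_eq_right]
    constructor
    · intro h
      have hne : {p : ι → ℝ | p ∈ stdSimplex ℝ ι ∧ ∑ i, p i • T i = 0}.Nonempty := by
        by_contra hne
        rw [Set.not_nonempty_iff_eq_empty, Set.eq_empty_iff_forall_notMem] at hne
        have : elikelihood T = 0 := by
          rw [elikelihood, Set.eq_empty_of_forall_notMem (s := {r : ℝ | ∃ p : ι → ℝ, _}),
            Real.sSup_empty]
          rintro _ ⟨p, p0, p1, pT, -⟩
          exact hne p ⟨⟨p0, p1⟩, pT⟩
        linarith
      have hcomp : IsCompact {p : ι → ℝ | p ∈ stdSimplex ℝ ι ∧ ∑ i, p i • T i = 0} :=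
        (isCompact_stdSimplex ℝ ι).inter_right (isClosed_eq (by fun_prop) continuous_const)
      obtain ⟨p, ⟨pS, pT⟩, hmax⟩ := hcomp.exists_isMaxOn hne
        (f := fun p => ∏ i, p i) (by fun_prop)
      refine ⟨⟨p, pS⟩, pT, h.trans ?_⟩
      refine csSup_le ⟨_, p, pS.1, pS.2, pT, rfl⟩ ?_
      rintro _ ⟨q, q0, q1, qT, rfl⟩
      exact hmax ⟨⟨q0, q1⟩, qT⟩
    · rintro ⟨p, pT, hr⟩
      exact hr.trans (le_csSup (hbdd T) ⟨p, p.2.1, p.2.2, pT, rfl⟩)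

end Finite

/-! ### Riemann sums on `[0,1]` -/

/-- The point `(i+1)/n` of `[0,1]`. -/
noncomputable def gridPt (n : ℕ) (i : Fin n) : I :=
  ⟨((i : ℝ) + 1) / n, by positivity, by
    have h : ((i : ℕ) : ℝ) + 1 ≤ n := by exact_mod_cast i.2
    exact div_le_one_of_le₀ h (by positivity)⟩

theorem exists_gridPt_near {n : ℕ} (hn : 0 < n) (t : I) :
    ∃ i : Fin n, dist (gridPt n i) t ≤ 1 / n := by
  have hn' : (0 : ℝ) < n := by exact_mod_cast hn
  have key : ∀ i : Fin n, ((i : ℕ) : ℝ) ≤ n * (t : ℝ) → (n : ℝ) * t ≤ (i : ℕ) + 1 →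
      dist (gridPt n i) t ≤ 1 / n := by
    intro i h1 h2
    rw [Subtype.dist_eq, Real.dist_eq, abs_le, gridPt]
    have e : (((i : ℕ) : ℝ) + 1) / n - t = ((i : ℕ) + 1 - n * t) / n := by field_simp
    simp only [e]
    constructor
    · exact le_trans (by simp) (div_nonneg (by linarith) hn'.le)
    · gcongr
      linarith
  rcases lt_or_ge ((n : ℝ) * t) n with h | h
  · exact ⟨⟨⌊(n : ℝ) * t⌋₊, (Nat.floor_lt (mul_nonneg hn'.le t.2.1)).2 h⟩,
      key _ (Nat.floor_le (mul_nonneg hn'.le t.2.1)) (Nat.lt_floor_add_one _).le⟩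
  -- At the endpoint `t = 1` the floor would be `n`, out of range; the last index serves.
  · have hc : ((n - 1 : ℕ) : ℝ) + 1 = n := by rw [Nat.cast_pred hn]; ring
    refine ⟨⟨n - 1, Nat.sub_lt hn one_pos⟩, key _ ?_ ?_⟩
    · change ((n - 1 : ℕ) : ℝ) ≤ _
      linarith
    · change _ ≤ ((n - 1 : ℕ) : ℝ) + 1
      rw [hc]
      exact mul_le_of_le_one_right hn'.le t.2.2

theorem tendsto_riemannSum (φ : C(I, ℝ)) :
    Tendsto (fun n : ℕ => (1 / (n : ℝ)) * ∑ i, φ (gridPt n i)) atTop (𝓝 (∫ t, φ t)) := by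
  set g : ℝ → ℝ := fun x => φ (Set.projIcc 0 1 zero_le_one x) with hg
  have hgc : Continuous g := φ.continuous.comp continuous_projIcc
  have hint : ∫ t, φ t = ∫ x in (0 : ℝ)..1, g x := by
    rw [intervalIntegral.integral_of_le zero_le_one, ← integral_Icc_eq_integral_Ioc,
      ← integral_subtype measurableSet_Icc g]
    exact integral_congr_ae (.of_forall fun t => by simp [hg])
  rw [hint, Metric.tendsto_atTop]
  intro ε hε
  obtain ⟨δ, hδ, hφ⟩ := Metric.uniformContinuous_iff.1
    (CompactSpace.uniformContinuous_of_continuous φ.continuous) (ε / 2) (half_pos hε)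
  obtain ⟨M, hM⟩ := exists_nat_gt (1 / δ)
  have hM0 : (0 : ℝ) < M := (div_pos one_pos hδ).trans hM
  refine ⟨M, fun n hn => ?_⟩
  have hn' : (0 : ℝ) < n := hM0.trans_le (by exact_mod_cast hn)
  have hnδ : 1 / (n : ℝ) < δ := by
    rw [div_lt_comm₀ hn' hδ]
    exact hM.trans_le (by exact_mod_cast hn)
  have hsplit : ∫ x in (0 : ℝ)..1, g x
      = ∑ k ∈ Finset.range n, ∫ x in ((k : ℝ) / n)..(((k + 1 : ℕ) : ℝ) / n), g x := by
    rw [intervalIntegral.sum_integral_adjacent_intervals (a := fun k : ℕ => (k : ℝ) / n)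
      fun k _ => hgc.intervalIntegrable _ _]
    simp [hn'.ne']
  have hsum : (1 / (n : ℝ)) * ∑ i, φ (gridPt n i)
      = ∑ k ∈ Finset.range n, ∫ _ in ((k : ℝ) / n)..(((k + 1 : ℕ) : ℝ) / n),
          g (((k : ℝ) + 1) / n) := by
    rw [Finset.mul_sum, ← Fin.sum_univ_eq_sum_range (fun k => ∫ _ in ((k : ℝ) / n)..
      (((k + 1 : ℕ) : ℝ) / n), g (((k : ℝ) + 1) / n))]
    refine Finset.sum_congr rfl fun i _ => ?_
    rw [intervalIntegral.integral_const, smul_eq_mul]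
    congr 1
    · push_cast; ring
    · exact congrArg φ (Set.projIcc_val zero_le_one (gridPt n i)).symm
  rw [Real.dist_eq, hsplit, hsum, ← Finset.sum_sub_distrib]
  refine (Finset.abs_sum_le_sum_abs _ _).trans_lt ?_
  have hterm : ∀ k ∈ Finset.range n, |(∫ _ in ((k : ℝ) / n)..(((k + 1 : ℕ) : ℝ) / n),
      g (((k : ℝ) + 1) / n)) - ∫ x in ((k : ℝ) / n)..(((k + 1 : ℕ) : ℝ) / n), g x|
        ≤ ε / 2 * (1 / n) := by
    intro k hk
    rw [← intervalIntegral.integral_sub (by simp) (hgc.intervalIntegrable _ _), ← Real.norm_eq_abs]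
    have hw : |((k + 1 : ℕ) : ℝ) / n - (k : ℝ) / n| = 1 / n := by
      rw [← sub_div, abs_of_nonneg] <;> push_cast <;> simp
    rw [← hw]
    refine intervalIntegral.norm_integral_le_of_norm_le_const fun x hx => ?_
    rw [Set.uIoc_of_le (by push_cast; gcongr; linarith)] at hx
    have hx1 := hx.1
    have hx2 := hx.2
    push_cast at hx2
    rw [← dist_eq_norm]
    refine (hφ ?_).le
    refine lt_of_le_of_lt ?_ hnδ
    rw [Subtype.dist_eq, Real.dist_eq]
    refine (Set.abs_projIcc_sub_projIcc zero_le_one).trans ?_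
    rw [abs_of_nonneg (by linarith)]
    have : ((k : ℝ) + 1) / n = k / n + 1 / n := add_div _ _ _
    linarith
  refine (Finset.sum_le_sum hterm).trans_lt ?_
  rw [Finset.sum_const, Finset.card_range, nsmul_eq_mul]
  field_simp
  linarith

/-- Riemann sums are `1`-Lipschitz in the supremum norm uniformly in `n`, which allows the integrand
to vary with the mesh. -/
theorem abs_riemannSum_sub_le (φ ψ : C(I, ℝ)) (n : ℕ) :
    |(1 / (n : ℝ)) * ∑ i, φ (gridPt n i) - (1 / (n : ℝ)) * ∑ i, ψ (gridPt n i)| ≤ dist φ ψ := by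
  rcases Nat.eq_zero_or_pos n with rfl | hn
  · simp
  have hn' : (0 : ℝ) < n := by exact_mod_cast hn
  rw [← mul_sub, ← Finset.sum_sub_distrib, abs_mul, abs_of_pos (by positivity)]
  calc 1 / (n : ℝ) * |∑ i, (φ (gridPt n i) - ψ (gridPt n i))|
      ≤ 1 / (n : ℝ) * ∑ _i : Fin n, dist φ ψ := by
        gcongr
        refine (Finset.abs_sum_le_sum_abs _ _).trans (Finset.sum_le_sum fun i _ => ?_)
        rw [← Real.dist_eq]
        exact ContinuousMap.dist_apply_le_dist _
    _ = dist φ ψ := by simp [hn'.ne']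

theorem tendsto_riemannSum_of_tendsto {α : Type*} {l : Filter α} {N : α → ℕ}
    (hN : Tendsto N l atTop) {Φ : α → C(I, ℝ)} {φ : C(I, ℝ)} (hΦ : Tendsto Φ l (𝓝 φ)) :
    Tendsto (fun x => (1 / (N x : ℝ)) * ∑ i, Φ x (gridPt (N x) i)) l (𝓝 (∫ t, φ t)) := by
  refine tendsto_of_tendsto_of_dist ((tendsto_riemannSum φ).comp hN) ?_
  refine squeeze_zero (fun _ => dist_nonneg) (fun x => ?_) (tendsto_iff_dist_tendsto_zero.1 hΦ)
  rw [Function.comp_apply, dist_comm, Real.dist_eq]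
  exact abs_riemannSum_sub_le _ _ _

/-! ### The logarithmic integral -/

/-- The logarithm truncated from below at `ε`. -/
noncomputable def truncLog (ε : ℝ) (hε : 0 < ε) : C(ℝ, ℝ) where
  toFun x := Real.log (max ε x)
  continuous_toFun := (continuous_const.max continuous_id).log
    fun _ => (hε.trans_le (le_max_left _ _)).ne'

theorem integrable_of_compactSpace (φ : C(I, ℝ)) : Integrable φ :=
  φ.continuous.integrable_of_hasCompactSupport (HasCompactSupport.of_compactSpace _)

theorem lintegral_posLog_ne_top (h : C(I, ℝ)) :
    ∫⁻ t, (ENNReal.log (ENNReal.ofReal (h t))).toENNReal ≠ ⊤ := by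
  obtain ⟨C, hC⟩ : ∃ C, ∀ t, h t ≤ C :=
    ⟨‖h‖, fun t => (le_abs_self _).trans (h.norm_coe_le_norm t)⟩
  refine ne_top_of_le_ne_top (b := ∫⁻ _ : I, (ENNReal.log (ENNReal.ofReal C)).toENNReal) ?_
    (lintegral_mono fun t => EReal.toENNReal_le_toENNReal
      (ENNReal.log_monotone (ENNReal.ofReal_le_ofReal (hC t))))
  rw [lintegral_const]
  refine ENNReal.mul_ne_top ?_ (measure_ne_top _ _)
  rw [EReal.toENNReal_ne_top_iff, Ne, ENNReal.log_eq_top_iff]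
  exact ENNReal.ofReal_ne_top

theorem toENNReal_log_ofReal (x : ℝ) (hx : 0 ≤ x) :
    (ENNReal.log (ENNReal.ofReal x)).toENNReal = ENNReal.ofReal (Real.log x) := by
  rcases hx.eq_or_lt with rfl | hx
  · simp
  · rw [ENNReal.log_ofReal_of_pos hx, EReal.real_coe_toENNReal]

/-- For truncation levels at most `1` the positive part of the logarithm is unaffected, while the
negative part increases as the level decreases; monotone convergence applies, and the finite
positive part rules out `∞ - ∞`. -/
theorem tendsto_negLogIntegral (h : C(I, ℝ)) (h0 : ∀ t, 0 ≤ h t) :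
    Tendsto (fun k : ℕ => ((-∫ t, truncLog (1 / ((k : ℝ) + 1)) Nat.one_div_pos_of_nat (h t) : ℝ) :
      EReal)) atTop (𝓝 (negLogIntegral h)) := by
  set ε : ℕ → ℝ := fun k => 1 / ((k : ℝ) + 1) with hε
  have hε0 : ∀ k, 0 < ε k := fun k => Nat.one_div_pos_of_nat
  have hε1 : ∀ k, ε k ≤ 1 := fun k => by
    rw [hε, div_le_one (by positivity)]; simp
  have hεanti : Antitone ε := fun a b hab => Nat.one_div_le_one_div hab
  set q := ∫⁻ t, (ENNReal.log (ENNReal.ofReal (h t))).toENNReal with hq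
  have hqt : q ≠ ⊤ := lintegral_posLog_ne_top h
  set p : ℕ → ℝ≥0∞ := fun k => ∫⁻ t, ENNReal.ofReal (-Real.log (max (ε k) (h t))) with hp
  have hterm : ∀ k, ((-∫ t, truncLog (ε k) (hε0 k) (h t) : ℝ) : EReal) = (p k : EReal) - q := by
    intro k
    have hi : Integrable fun t => truncLog (ε k) (hε0 k) (h t) :=
      integrable_of_compactSpace ((truncLog (ε k) (hε0 k)).comp h)
    have hneg : ∫⁻ t, ENNReal.ofReal (truncLog (ε k) (hε0 k) (h t)) = q := by
      refine lintegral_congr fun t => ?_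
      rw [toENNReal_log_ofReal _ (h0 t)]
      change ENNReal.ofReal (Real.log (max (ε k) (h t))) = _
      rcases le_total (ε k) (h t) with h1 | h1
      · rw [max_eq_right h1]
      · rw [max_eq_left h1, ENNReal.ofReal_of_nonpos (Real.log_nonpos (hε0 k).le (hε1 k)),
          ENNReal.ofReal_of_nonpos (Real.log_nonpos (h0 t) (h1.trans (hε1 k)))]
    have hpt : p k ≠ ⊤ := hi.neg.lintegral_lt_top.ne
    rw [integral_eq_lintegral_pos_part_sub_lintegral_neg_part hi, hneg, neg_sub, EReal.coe_sub,
      EReal.coe_ennreal_toReal hqt]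
    exact congrArg (fun x : EReal => x - q) (EReal.coe_ennreal_toReal hpt)
  have hlim : Tendsto p atTop (𝓝 (∫⁻ t, (-ENNReal.log (ENNReal.ofReal (h t))).toENNReal)) := by
    refine lintegral_tendsto_of_tendsto_of_monotone (fun k => ?_) (.of_forall fun t => ?_)
      (.of_forall fun t => ?_)
    · exact ((((truncLog (ε k) (hε0 k)).comp
      h).continuous.neg).measurable.ennreal_ofReal).aemeasurable
    · intro a b hab
      refine ENNReal.ofReal_le_ofReal (neg_le_neg (Real.log_le_log
        ((hε0 b).trans_le (le_max_left _ _)) (max_le_max_right _ (hεanti hab))))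
    · rcases (h0 t).eq_or_lt with h1 | h1
      · simp only [← h1, ENNReal.ofReal_zero, ENNReal.log_zero, EReal.neg_bot, EReal.toENNReal_top]
        refine ENNReal.tendsto_ofReal_atTop.comp (tendsto_neg_atBot_atTop.comp ?_)
        have h2 : ∀ k, max (ε k) 0 = ε k := fun k => max_eq_left (hε0 k).le
        simp only [h2]
        exact Real.tendsto_log_nhdsGT_zero.comp (tendsto_nhdsWithin_iff.2
          ⟨tendsto_one_div_add_atTop_nhds_zero_nat, .of_forall hε0⟩)
      · rw [ENNReal.log_ofReal_of_pos h1, ← EReal.coe_neg, EReal.real_coe_toENNReal]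
        refine tendsto_const_nhds.congr' ?_
        have : Tendsto ε atTop (𝓝 0) := tendsto_one_div_add_atTop_nhds_zero_nat
        filter_upwards [this.eventually (gt_mem_nhds h1)] with k hk
        rw [max_eq_right hk.le]
  refine (tendsto_congr hterm).2 ?_
  simp only [negLogIntegral, sub_eq_add_neg]
  have hc := EReal.continuousAt_add (p := ((∫⁻ t, (-ENNReal.log (ENNReal.ofReal (h t))).toENNReal :
    ℝ≥0∞), -(q : EReal))) (Or.inr (by simpa using hqt)) (Or.inl (by simp))
  exact hc.tendsto.comp ((EReal.tendsto_coe_ennreal.2 hlim).prodMk_nhds tendsto_const_nhds)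

theorem negLogIntegral_of_ne_top (h : C(I, ℝ)) (h0 : ∀ t, 0 ≤ h t) (hf : negLogIntegral h ≠ ⊤) :
    (∀ᵐ t, 0 < h t) ∧ Integrable (fun t => Real.log (h t)) ∧
      negLogIntegral h = ((-∫ t, Real.log (h t) : ℝ) : EReal) := by
  have hqt := lintegral_posLog_ne_top h
  have hpt : ∫⁻ t, (-ENNReal.log (ENNReal.ofReal (h t))).toENNReal ≠ ⊤ := by
    intro hp
    apply hf
    rw [negLogIntegral, hp, EReal.coe_ennreal_top, EReal.top_sub (by simpa using hqt)]
  have hpm : Measurable fun t : I => (-ENNReal.log (ENNReal.ofReal (h t))).toENNReal := by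
    have := h.continuous.measurable
    fun_prop
  have hpos : ∀ᵐ t, 0 < h t := by
    filter_upwards [ae_lt_top hpm hpt] with t ht
    refine lt_of_le_of_ne (h0 t) fun h1 => ht.ne ?_
    simp [← h1]
  have e1 : ∫⁻ t, (-ENNReal.log (ENNReal.ofReal (h t))).toENNReal
      = ∫⁻ t, ENNReal.ofReal (-Real.log (h t)) := by
    refine lintegral_congr_ae ?_
    filter_upwards [hpos] with t ht
    rw [ENNReal.log_ofReal_of_pos ht, ← EReal.coe_neg, EReal.real_coe_toENNReal]
  have e2 : ∫⁻ t, (ENNReal.log (ENNReal.ofReal (h t))).toENNReal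
      = ∫⁻ t, ENNReal.ofReal (Real.log (h t)) :=
    lintegral_congr fun t => toENNReal_log_ofReal _ (h0 t)
  have hlogm : Measurable fun t : I => Real.log (h t) := h.continuous.measurable.log
  have hi : Integrable (fun t => Real.log (h t)) := by
    refine ⟨hlogm.aestronglyMeasurable, ?_⟩
    rw [hasFiniteIntegral_iff_norm]
    have hb : ∀ t, ENNReal.ofReal ‖Real.log (h t)‖
        = ENNReal.ofReal (Real.log (h t)) + ENNReal.ofReal (-Real.log (h t)) := fun t => by
      rw [Real.norm_eq_abs]
      rcases le_total 0 (Real.log (h t)) with h1 | h1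
      · rw [abs_of_nonneg h1, ENNReal.ofReal_of_nonpos (neg_nonpos.2 h1), add_zero]
      · rw [abs_of_nonpos h1, ENNReal.ofReal_of_nonpos h1, zero_add]
    rw [lintegral_congr hb, lintegral_add_left hlogm.ennreal_ofReal, ← e1, ← e2]
    exact ENNReal.add_lt_top.2 ⟨hqt.lt_top, hpt.lt_top⟩
  refine ⟨hpos, hi, ?_⟩
  rw [integral_eq_lintegral_pos_part_sub_lintegral_neg_part hi, ← e1, ← e2, neg_sub, EReal.coe_sub,
    EReal.coe_ennreal_toReal hpt, EReal.coe_ennreal_toReal hqt, negLogIntegral]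

theorem negLogIntegral_ne_bot (h : C(I, ℝ)) : negLogIntegral h ≠ ⊥ := by
  rw [negLogIntegral, sub_eq_add_neg, Ne, EReal.add_eq_bot_iff, not_or]
  exact ⟨EReal.coe_ennreal_ne_bot _, by simpa using lintegral_posLog_ne_top h⟩

/-- An integrable minorant of `log h` lies below every truncation, so integrability of `log h` need
not be known beforehand. -/
theorem negLogIntegral_le {h : C(I, ℝ)} (h0 : ∀ t, 0 ≤ h t) {g : I → ℝ} (hg : Integrable g)
    (hgh : ∀ᵐ t, 0 < h t ∧ g t ≤ Real.log (h t)) :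
    negLogIntegral h ≤ ((-∫ t, g t : ℝ) : EReal) := by
  refine le_of_tendsto' (tendsto_negLogIntegral h h0) fun k => EReal.coe_le_coe_iff.2 ?_
  refine neg_le_neg (integral_mono_ae hg
    (integrable_of_compactSpace ((truncLog _ Nat.one_div_pos_of_nat).comp h)) ?_)
  filter_upwards [hgh] with t ht
  exact ht.2.trans (Real.log_le_log ht.1 (le_max_right _ _))

theorem negLogIntegral_eq_of_le {h : C(I, ℝ)} {δ : ℝ} (hδ : 0 < δ) (hh : ∀ t, δ ≤ h t) :
    negLogIntegral h = ((-∫ t, truncLog δ hδ (h t) : ℝ) : EReal) := by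
  refine tendsto_nhds_unique (tendsto_negLogIntegral h fun t => hδ.le.trans (hh t)) ?_
  refine tendsto_const_nhds.congr' ?_
  have : Tendsto (fun k : ℕ => 1 / ((k : ℝ) + 1)) atTop (𝓝 0) :=
    tendsto_one_div_add_atTop_nhds_zero_nat
  filter_upwards [this.eventually (gt_mem_nhds hδ)] with k hk
  congr 3
  funext t
  change Real.log (max δ (h t)) = Real.log (max _ (h t))
  rw [max_eq_right (hh t), max_eq_right (hk.le.trans (hh t))]

theorem volume_pos_of_isOpen {U : Set I} (hU : IsOpen U) (hne : U.Nonempty) : 0 < volume U := by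
  obtain ⟨t, ht⟩ := hne
  have hV : IsOpen (Set.projIcc (0 : ℝ) 1 zero_le_one ⁻¹' U) := hU.preimage continuous_projIcc
  have htV : (t : ℝ) ∈ Set.projIcc (0 : ℝ) 1 zero_le_one ⁻¹' U := by
    rwa [Set.mem_preimage, Set.projIcc_val]
  -- The given point may be an endpoint of `[0,1]`; the open set still meets the open interval.
  have htc : (t : ℝ) ∈ closure (Set.Ioo (0 : ℝ) 1) := by
    rw [closure_Ioo zero_ne_one]; exact t.2
  have hpos := (hV.inter isOpen_Ioo).measure_pos volume (mem_closure_iff.1 htc _ hV htV)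
  rw [Measure.Subtype.volume_def, comap_subtype_coe_apply measurableSet_Icc]
  refine hpos.trans_le (measure_mono ?_)
  rintro x ⟨hx, hx'⟩
  have hxI : x ∈ Set.Icc (0 : ℝ) 1 := Set.Ioo_subset_Icc_self hx'
  refine ⟨⟨x, hxI⟩, ?_, rfl⟩
  rwa [Set.mem_preimage, Set.projIcc_of_mem zero_le_one hxI] at hx

/-! ### The limiting objective -/

section Objective

variable {d : ℕ} {w : ℝ → ℝ}

theorem continuous_limitFwd (hw : Continuous fun t : I => w t) :
    Continuous fun q : C(I, E d) × I => limitFwd w q.1 q.2 := by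
  unfold limitFwd
  exact (hw.comp continuous_snd).smul (by fun_prop)

theorem continuous_limitBwd (hw : Continuous fun t : I => w t) :
    Continuous fun q : C(I, E d) × I => limitBwd w q.1 q.2 := by
  unfold limitBwd
  exact (hw.comp continuous_snd).smul (by fun_prop)

/-- `1 + a'f` as a continuous function. -/
noncomputable def slackFwd (hw : Continuous fun t : I => w t) (b : C(I, E d)) (a : E d) : C(I, ℝ)
    where
  toFun t := 1 + inner ℝ a (limitFwd w b t)
  continuous_toFun := continuous_const.add (continuous_const.inner
    ((continuous_limitFwd hw).comp (continuous_const.prodMk continuous_id)))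

/-- `1 + a'f̃` as a continuous function. -/
noncomputable def slackBwd (hw : Continuous fun t : I => w t) (b : C(I, E d)) (a : E d) : C(I, ℝ)
    where
  toFun t := 1 + inner ℝ a (limitBwd w b t)
  continuous_toFun := continuous_const.add (continuous_const.inner
    ((continuous_limitBwd hw).comp (continuous_const.prodMk continuous_id)))

theorem continuous_slackFwd (hw : Continuous fun t : I => w t) :
    Continuous fun q : C(I, E d) × E d => slackFwd hw q.1 q.2 := by
  refine ContinuousMap.continuous_of_continuous_uncurry _ ?_
  have h : Continuous fun q : (C(I, E d) × E d) × I => limitFwd w q.1.1 q.2 :=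
    (continuous_limitFwd hw).comp (continuous_fst.fst.prodMk continuous_snd)
  exact continuous_const.add (continuous_fst.snd.inner h)

theorem continuous_slackBwd (hw : Continuous fun t : I => w t) :
    Continuous fun q : C(I, E d) × E d => slackBwd hw q.1 q.2 := by
  refine ContinuousMap.continuous_of_continuous_uncurry _ ?_
  have h : Continuous fun q : (C(I, E d) × E d) × I => limitBwd w q.1.1 q.2 :=
    (continuous_limitBwd hw).comp (continuous_fst.fst.prodMk continuous_snd)
  exact continuous_const.add (continuous_fst.snd.inner h)

/-- The limiting log-likelihood ratio with the logarithm truncated at `ε`. -/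
noncomputable def truncVal (hw : Continuous fun t : I => w t) (b : C(I, E d)) (a : E d) (ε : ℝ)
    (hε : 0 < ε) : ℝ :=
  (∫ t, truncLog ε hε (slackFwd hw b a t)) + ∫ t, truncLog ε hε (slackBwd hw b a t)

/-- The limiting log-likelihood ratio, as a real number. -/
noncomputable def logVal (hw : Continuous fun t : I => w t) (b : C(I, E d)) (a : E d) : ℝ :=
  (∫ t, Real.log (slackFwd hw b a t)) + ∫ t, Real.log (slackBwd hw b a t)

variable {b : C(I, E d)} {a y : E d}

theorem limitObj_ne_bot (hw : Continuous fun t : I => w t) : limitObj w b a ≠ ⊥ := by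
  rw [limitObj, Ne, EReal.add_eq_bot_iff, not_or]
  exact ⟨negLogIntegral_ne_bot (slackFwd hw b a), negLogIntegral_ne_bot (slackBwd hw b a)⟩

theorem tendsto_truncVal (hw : Continuous fun t : I => w t) (ha : a ∈ limitDomain w b) :
    Tendsto (fun k : ℕ => ((-truncVal hw b a (1 / ((k : ℝ) + 1)) Nat.one_div_pos_of_nat : ℝ) :
      EReal)) atTop (𝓝 (limitObj w b a)) := by
  have hc := EReal.continuousAt_add (p := (negLogIntegral (slackFwd hw b a),
    negLogIntegral (slackBwd hw b a))) (Or.inr (negLogIntegral_ne_bot _))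
    (Or.inl (negLogIntegral_ne_bot _))
  refine (hc.tendsto.comp ((tendsto_negLogIntegral (slackFwd hw b a) ha.1).prodMk_nhds
    (tendsto_negLogIntegral (slackBwd hw b a) ha.2))).congr fun k => ?_
  rw [truncVal, neg_add, EReal.coe_add]
  rfl

theorem limitObj_eq_truncVal (hw : Continuous fun t : I => w t) {δ : ℝ} (hδ : 0 < δ)
    (h1 : ∀ t, δ ≤ slackFwd hw b a t)
    (h2 : ∀ t, δ ≤ slackBwd hw b a t) :
    limitObj w b a = ((-truncVal hw b a δ hδ : ℝ) : EReal) := by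
  rw [truncVal, neg_add, EReal.coe_add, ← negLogIntegral_eq_of_le hδ h1,
    ← negLogIntegral_eq_of_le hδ h2]
  rfl

theorem limitObj_of_ne_top (hw : Continuous fun t : I => w t) (ha : a ∈ limitDomain w b)
    (hf : limitObj w b a ≠ ⊤) :
    ((∀ᵐ t, 0 < slackFwd hw b a t) ∧ Integrable fun t => Real.log (slackFwd hw b a t)) ∧
    ((∀ᵐ t, 0 < slackBwd hw b a t) ∧ Integrable fun t => Real.log (slackBwd hw b a t)) ∧
    limitObj w b a = ((-logVal hw b a : ℝ) : EReal) := by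
  have h1 : negLogIntegral (slackFwd hw b a) ≠ ⊤ := fun h => hf <| by
    change negLogIntegral (slackFwd hw b a) + negLogIntegral (slackBwd hw b a) = ⊤
    rw [h, EReal.top_add_of_ne_bot (negLogIntegral_ne_bot _)]
  have h2 : negLogIntegral (slackBwd hw b a) ≠ ⊤ := fun h => hf <| by
    change negLogIntegral (slackFwd hw b a) + negLogIntegral (slackBwd hw b a) = ⊤
    rw [h, EReal.add_top_of_ne_bot (negLogIntegral_ne_bot _)]
  obtain ⟨p1, i1, e1⟩ := negLogIntegral_of_ne_top _ ha.1 h1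
  obtain ⟨p2, i2, e2⟩ := negLogIntegral_of_ne_top _ ha.2 h2
  refine ⟨⟨p1, i1⟩, ⟨p2, i2⟩, ?_⟩
  rw [logVal, neg_add, EReal.coe_add, ← e1, ← e2]
  rfl

theorem limitObj_le (hw : Continuous fun t : I => w t) (ha : a ∈ limitDomain w b) {g₁ g₂ : I → ℝ}
    (i1 : Integrable g₁)
    (i2 : Integrable g₂) (h1 : ∀ᵐ t, 0 < slackFwd hw b a t ∧ g₁ t ≤ Real.log (slackFwd hw b a t))
    (h2 : ∀ᵐ t, 0 < slackBwd hw b a t ∧ g₂ t ≤ Real.log (slackBwd hw b a t)) :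
    limitObj w b a ≤ ((-((∫ t, g₁ t) + ∫ t, g₂ t) : ℝ) : EReal) := by
  rw [neg_add, EReal.coe_add]
  exact add_le_add (negLogIntegral_le (h := slackFwd hw b a) ha.1 i1 h1)
    (negLogIntegral_le (h := slackBwd hw b a) ha.2 i2 h2)

theorem zero_mem_limitDomain : (0 : E d) ∈ limitDomain w b := by
  simp [limitDomain]

theorem limitObj_zero (hw : Continuous fun t : I => w t) : limitObj w b 0 = 0 := by
  rw [limitObj_eq_truncVal hw one_pos (by simp [slackFwd]) (by simp [slackBwd])]
  simp [truncVal, truncLog, slackFwd, slackBwd]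

theorem slackFwd_smul (hw : Continuous fun t : I => w t) (s : ℝ) (t : I) :
    slackFwd hw b (s • a) t = (1 - s) * 1 + s * slackFwd hw b a t := by
  simp only [slackFwd, ContinuousMap.coe_mk, real_inner_smul_left]; ring

theorem slackBwd_smul (hw : Continuous fun t : I => w t) (s : ℝ) (t : I) :
    slackBwd hw b (s • a) t = (1 - s) * 1 + s * slackBwd hw b a t := by
  simp only [slackBwd, ContinuousMap.coe_mk, real_inner_smul_left]; ring

/-- At `0` every slack is `1`, so shrinking a domain point towards `0` leaves slack at least `1 -
s`. Such points remain feasible under small perturbations of the path. -/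
theorem limitDomain_smul (hw : Continuous fun t : I => w t) (ha : a ∈ limitDomain w b) {s : ℝ}
    (hs : s ∈ Set.Ioo (0 : ℝ) 1) :
    (∀ t, 1 - s ≤ slackFwd hw b (s • a) t) ∧ (∀ t, 1 - s ≤ slackBwd hw b (s • a) t) ∧
      s • a ∈ limitDomain w b := by
  have h1 : ∀ t, 1 - s ≤ slackFwd hw b (s • a) t := fun t => by
    rw [slackFwd_smul]
    have : 0 ≤ s * slackFwd hw b a t := mul_nonneg hs.1.le (ha.1 t)
    linarith
  have h2 : ∀ t, 1 - s ≤ slackBwd hw b (s • a) t := fun t => by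
    rw [slackBwd_smul]
    have : 0 ≤ s * slackBwd hw b a t := mul_nonneg hs.1.le (ha.2 t)
    linarith
  have hs1 := hs.2
  exact ⟨h1, h2, fun t => le_trans (by linarith) (h1 t), fun t => le_trans (by linarith) (h2 t)⟩

theorem log_convex_comb {s x : ℝ} (hs : s ∈ Set.Ioo (0 : ℝ) 1) (hx : 0 < x) :
    s * Real.log x ≤ Real.log ((1 - s) * 1 + s * x) := by
  have := strictConcaveOn_log_Ioi.concaveOn.2 (x := 1) (y := x) (by simp) hx
    (sub_nonneg.2 hs.2.le) hs.1.le (by ring)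
  simpa using this

/-- Convexity of the limiting objective along rays. -/
theorem limitObj_smul_le (hw : Continuous fun t : I => w t) (ha : a ∈ limitDomain w b)
    (hf : limitObj w b a ≠ ⊤) {s : ℝ}
    (hs : s ∈ Set.Ioo (0 : ℝ) 1) : limitObj w b (s • a) ≤ ((-(s * logVal hw b a) : ℝ) : EReal) := by
  obtain ⟨⟨p1, i1⟩, ⟨p2, i2⟩, -⟩ := limitObj_of_ne_top hw ha hf
  obtain ⟨h1, h2, h3⟩ := limitDomain_smul hw ha hs
  have hs1 := sub_pos.2 hs.2
  rw [logVal, mul_add, ← integral_const_mul, ← integral_const_mul]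
  refine limitObj_le hw h3 (i1.const_mul s) (i2.const_mul s) ?_ ?_
  · filter_upwards [p1] with t ht
    refine ⟨hs1.trans_le (h1 t), ?_⟩
    rw [slackFwd_smul]
    exact log_convex_comb hs ht
  · filter_upwards [p2] with t ht
    refine ⟨hs1.trans_le (h2 t), ?_⟩
    rw [slackBwd_smul]
    exact log_convex_comb hs ht

theorem log_midpoint_ge {x z : ℝ} (hx : 0 < x) (hz : 0 < z) :
    2⁻¹ * Real.log x + 2⁻¹ * Real.log z ≤ Real.log (2⁻¹ * x + 2⁻¹ * z) := by
  simpa using strictConcaveOn_log_Ioi.concaveOn.2 hx hz (by norm_num : (0 : ℝ) ≤ 2⁻¹)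
    (by norm_num) (by norm_num)

theorem log_midpoint_gt {x z : ℝ} (hx : 0 < x) (hz : 0 < z) (hne : x ≠ z) :
    2⁻¹ * Real.log x + 2⁻¹ * Real.log z < Real.log (2⁻¹ * x + 2⁻¹ * z) := by
  simpa using strictConcaveOn_log_Ioi.2 hx hz hne (by norm_num : (0 : ℝ) < 2⁻¹)
    (by norm_num) (by norm_num)

theorem slackFwd_midpoint (hw : Continuous fun t : I => w t) (t : I) : slackFwd hw b
    ((2⁻¹ : ℝ) • a + (2⁻¹ : ℝ) • y) t
    = 2⁻¹ * slackFwd hw b a t + 2⁻¹ * slackFwd hw b y t := by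
  simp only [slackFwd, ContinuousMap.coe_mk, real_inner_smul_left, inner_add_left]; ring

theorem slackBwd_midpoint (hw : Continuous fun t : I => w t) (t : I) : slackBwd hw b
    ((2⁻¹ : ℝ) • a + (2⁻¹ : ℝ) • y) t
    = 2⁻¹ * slackBwd hw b a t + 2⁻¹ * slackBwd hw b y t := by
  simp only [slackBwd, ContinuousMap.coe_mk, real_inner_smul_left, inner_add_left]; ring

/-- A minimizer of the limiting objective is unique when the forward path meets every open
half-space. -/
theorem isUniqueMinimizer_of_forall_le (hw : Continuous fun t : I => w t)
    (hb : ∀ u : E d, u ≠ 0 → ∃ t, inner ℝ u (limitFwd w b t) < 0) (hy : y ∈ limitDomain w b)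
    (hmin : ∀ a ∈ limitDomain w b, limitObj w b y ≤ limitObj w b a) :
    IsUniqueMinimizer w b y := by
  refine ⟨hy, fun a ha hne => lt_of_not_ge fun hle => ?_⟩
  have hyt : limitObj w b y ≠ ⊤ := by
    refine ne_top_of_le_ne_top ?_ (hmin 0 zero_mem_limitDomain)
    rw [limitObj_zero hw]
    exact EReal.zero_ne_top
  have hat : limitObj w b a ≠ ⊤ := ne_top_of_le_ne_top hyt hle
  obtain ⟨⟨p1, i1⟩, ⟨p2, i2⟩, e⟩ := limitObj_of_ne_top hw hy hyt
  obtain ⟨⟨p1', i1'⟩, ⟨p2', i2'⟩, e'⟩ := limitObj_of_ne_top hw ha hat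
  -- The midpoint of two minimizers would do strictly better. The backward part needs only
  -- concavity; the strict gain comes from the forward part.
  set c := (2⁻¹ : ℝ) • a + (2⁻¹ : ℝ) • y with hc
  have hcd : c ∈ limitDomain w b := by
    refine ⟨fun t => ?_, fun t => ?_⟩
    · change 0 ≤ slackFwd hw b c t
      rw [hc, slackFwd_midpoint]
      have h1 : 0 ≤ slackFwd hw b a t := ha.1 t
      have h2 : 0 ≤ slackFwd hw b y t := hy.1 t
      positivity
    · change 0 ≤ slackBwd hw b c t
      rw [hc, slackBwd_midpoint]
      have h1 : 0 ≤ slackBwd hw b a t := ha.2 t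
      have h2 : 0 ≤ slackBwd hw b y t := hy.2 t
      positivity
  have g1 : Integrable fun t => 2⁻¹ * Real.log (slackFwd hw b a t) +
      2⁻¹ * Real.log (slackFwd hw b y t) :=
    (i1'.const_mul 2⁻¹).add (i1.const_mul 2⁻¹)
  have g2 : Integrable fun t => 2⁻¹ * Real.log (slackBwd hw b a t) +
      2⁻¹ * Real.log (slackBwd hw b y t) :=
    (i2'.const_mul 2⁻¹).add (i2.const_mul 2⁻¹)
  have q1 : ∀ᵐ t, 0 < slackFwd hw b c t ∧ 2⁻¹ * Real.log (slackFwd hw b a t) +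
      2⁻¹ * Real.log (slackFwd hw b y t) ≤ Real.log (slackFwd hw b c t) := by
    filter_upwards [p1, p1'] with t ht ht'
    rw [hc, slackFwd_midpoint]
    exact ⟨by positivity, log_midpoint_ge ht' ht⟩
  have q2 : ∀ᵐ t, 0 < slackBwd hw b c t ∧ 2⁻¹ * Real.log (slackBwd hw b a t) +
      2⁻¹ * Real.log (slackBwd hw b y t) ≤ Real.log (slackBwd hw b c t) := by
    filter_upwards [p2, p2'] with t ht ht'
    rw [hc, slackBwd_midpoint]
    exact ⟨by positivity, log_midpoint_ge ht' ht⟩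
  have hct : limitObj w b c ≠ ⊤ :=
    ne_top_of_le_ne_top (EReal.coe_ne_top _) (limitObj_le hw hcd g1 g2 q1 q2)
  obtain ⟨⟨-, j1⟩, ⟨-, j2⟩, e''⟩ := limitObj_of_ne_top hw hcd hct
  have hle2 : 2⁻¹ * (∫ t, Real.log (slackBwd hw b a t)) + 2⁻¹ * ∫ t, Real.log (slackBwd hw b y t)
      ≤ ∫ t, Real.log (slackBwd hw b c t) := by
    rw [← integral_const_mul, ← integral_const_mul,
      ← integral_add (i2'.const_mul _) (i2.const_mul _)]
    exact integral_mono_ae g2 j2 (q2.mono fun t ht => ht.2)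
  have hlt1 : 2⁻¹ * (∫ t, Real.log (slackFwd hw b a t)) + 2⁻¹ * ∫ t, Real.log (slackFwd hw b y t)
      < ∫ t, Real.log (slackFwd hw b c t) := by
    rw [← integral_const_mul, ← integral_const_mul,
      ← integral_add (i1'.const_mul _) (i1.const_mul _), ← sub_pos, ← integral_sub j1 g1,
      integral_pos_iff_support_of_nonneg_ae (q1.mono fun t ht => sub_nonneg.2 ht.2) (j1.sub g1)]
    -- The forward slacks of `a` and `y` differ at `t₀`, hence on a nonempty open set, which has
    -- positive measure.
    obtain ⟨t₀, ht₀⟩ := hb (a - y) (sub_ne_zero.2 hne)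
    have hopen : IsOpen {t | slackFwd hw b a t ≠ slackFwd hw b y t} :=
      isOpen_ne_fun (slackFwd hw b a).continuous (slackFwd hw b y).continuous
    have hpos := volume_pos_of_isOpen hopen ⟨t₀, fun h => by
      rw [inner_sub_left] at ht₀
      have : inner ℝ a (limitFwd w b t₀) = inner ℝ y (limitFwd w b t₀) := add_left_cancel h
      linarith⟩
    refine hpos.trans_le (measure_mono_ae ?_)
    filter_upwards [p1, p1'] with t ht ht' hne'
    change Real.log (slackFwd hw b c t) - _ ≠ 0
    rw [hc, slackFwd_midpoint]
    exact (sub_pos.2 (log_midpoint_gt ht' ht hne')).ne'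
  have h1 := hmin c hcd
  rw [e, e'', EReal.coe_le_coe_iff] at h1
  rw [e, e', EReal.coe_le_coe_iff] at hle
  simp only [logVal] at h1 hle
  linarith

theorem IsUniqueMinimizer.le (h : IsUniqueMinimizer w b y) (ha : a ∈ limitDomain w b) :
    limitObj w b y ≤ limitObj w b a := by
  rcases eq_or_ne a y with rfl | hne
  · exact le_rfl
  · exact (h.2 a ha hne).le

theorem IsUniqueMinimizer.ne_top (hw : Continuous fun t : I => w t) (h : IsUniqueMinimizer w b y) :
    limitObj w b y ≠ ⊤ := by
  refine ne_top_of_le_ne_top ?_ (h.le zero_mem_limitDomain)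
  rw [limitObj_zero hw]
  exact EReal.zero_ne_top

theorem sub_two_mul_sq_le_log {x : ℝ} (hx : |x| ≤ 2⁻¹) : x - 2 * x ^ 2 ≤ Real.log (1 + x) := by
  have h1 := (abs_le.1 hx).1
  have h2 : (0 : ℝ) < 1 + x := by linarith [show (2⁻¹ : ℝ) < 1 by norm_num]
  refine le_trans ?_ (Real.one_sub_inv_le_log_of_pos h2)
  have h3 : 1 - (1 + x)⁻¹ = x - x ^ 2 * (1 + x)⁻¹ := by field_simp; ring
  have h4 : (1 + x)⁻¹ ≤ 2 := by
    rw [inv_le_comm₀ h2 two_pos]; linarith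
  rw [h3]
  nlinarith [sq_nonneg x]

/-- The minimum is negative if the objective has a nonzero directional derivative at `0`. -/
theorem IsUniqueMinimizer.neg (hw : Continuous fun t : I => w t) (h : IsUniqueMinimizer w b y)
    {v : E d}
    (hv : 0 < (∫ t, inner ℝ v (limitFwd w b t)) + ∫ t, inner ℝ v (limitBwd w b t)) :
    limitObj w b y < 0 := by
  set φ : C(I, ℝ) := slackFwd hw b v - 1 with hφ
  set ψ : C(I, ℝ) := slackBwd hw b v - 1 with hψ
  have hφa : ∀ t, φ t = inner ℝ v (limitFwd w b t) := fun t => by simp [hφ, slackFwd]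
  have hψa : ∀ t, ψ t = inner ℝ v (limitBwd w b t) := fun t => by simp [hψ, slackBwd]
  simp only [← hφa, ← hψa] at hv
  set c := (∫ t, φ t) + ∫ t, ψ t with hc
  set M := ‖φ‖ + ‖ψ‖ + 1 with hM
  have hM0 : 0 < M := by positivity
  -- The first bound keeps the perturbations within `1/2`, where the quadratic estimate of the
  -- logarithm holds; the second makes the total error `4 (s M)²` at most half of the gain `s c`.
  set s := min (2⁻¹ / M) (c / (8 * M ^ 2)) with hs
  have hs0 : 0 < s := lt_min (by positivity) (by positivity)
  have hsM : s * M ≤ 2⁻¹ := (le_div_iff₀ hM0).1 (min_le_left _ _)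
  have hsc : s * (8 * M ^ 2) ≤ c := (le_div_iff₀ (by positivity)).1 (min_le_right _ _)
  have bφ : ∀ t, |s * φ t| ≤ s * M := fun t => by
    rw [abs_mul, abs_of_pos hs0]
    gcongr
    have := φ.norm_coe_le_norm t
    rw [Real.norm_eq_abs] at this
    linarith [norm_nonneg ψ]
  have bψ : ∀ t, |s * ψ t| ≤ s * M := fun t => by
    rw [abs_mul, abs_of_pos hs0]
    gcongr
    have := ψ.norm_coe_le_norm t
    rw [Real.norm_eq_abs] at this
    linarith [norm_nonneg φ]
  have e1 : ∀ t, slackFwd hw b (s • v) t = 1 + s * φ t := fun t => by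
    simp [slackFwd, real_inner_smul_left, hφa]
  have e2 : ∀ t, slackBwd hw b (s • v) t = 1 + s * ψ t := fun t => by
    simp [slackBwd, real_inner_smul_left, hψa]
  have key : ∀ x : ℝ, |x| ≤ s * M → 0 < 1 + x ∧ x - 2 * (s * M) ^ 2 ≤ Real.log (1 + x) := by
    intro x hx
    have h1 := (abs_le.1 (hx.trans hsM)).1
    refine ⟨by linarith [show (2⁻¹ : ℝ) < 1 by norm_num], ?_⟩
    refine le_trans ?_ (sub_two_mul_sq_le_log (hx.trans hsM))
    have : x ^ 2 ≤ (s * M) ^ 2 := sq_le_sq' (abs_le.1 hx).1 (abs_le.1 hx).2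
    linarith
  have hd : s • v ∈ limitDomain w b :=
    ⟨fun t => (e1 t ▸ (key _ (bφ t)).1.le : 0 ≤ slackFwd hw b (s • v) t),
      fun t => (e2 t ▸ (key _ (bψ t)).1.le : 0 ≤ slackBwd hw b (s • v) t)⟩
  have iφ := (integrable_of_compactSpace φ).const_mul s
  have iψ := (integrable_of_compactSpace ψ).const_mul s
  have hle := limitObj_le hw hd (iφ.sub (integrable_const (2 * (s * M) ^ 2)))
    (iψ.sub (integrable_const (2 * (s * M) ^ 2)))
    (.of_forall fun t => by rw [e1]; exact key _ (bφ t))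
    (.of_forall fun t => by rw [e2]; exact key _ (bψ t))
  refine (h.le hd).trans_lt (hle.trans_lt ?_)
  simp only [Pi.sub_apply]
  rw [integral_sub iφ (integrable_const _), integral_sub iψ (integrable_const _),
    integral_const, integral_const_mul s ψ, integral_const_mul s φ, ← EReal.coe_zero,
    EReal.coe_lt_coe_iff]
  simp only [probReal_univ, one_smul]
  have : s * (s * (8 * M ^ 2)) ≤ s * c := mul_le_mul_of_nonneg_left hsc hs0.le
  have h3 : 0 < s * c := mul_pos hs0 hv
  rw [hc] at this h3
  nlinarith

end Objective

/-! ### Convergence of the multipliers along a convergent sequence of paths -/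

section Deterministic

variable {d : ℕ} {w : ℝ → ℝ}

/-- The block sums of a path, on the grid of mesh `1/n`. -/
noncomputable def pathBlock (w : ℝ → ℝ) (b : C(I, E d)) (n : ℕ) : Fin n ⊕ Fin n → E d :=
  Sum.elim (fun i => limitFwd w b (gridPt n i)) (fun i => limitBwd w b (gridPt n i))

/-- The log-likelihood ratio of the block sums at `a`, divided by `-n`. -/
noncomputable def gridVal (w : ℝ → ℝ) (b : C(I, E d)) (n : ℕ) (a : E d) : ℝ :=
  (1 / (n : ℝ)) * ∑ i, Real.log (1 + inner ℝ a (pathBlock w b n i))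

variable {α : Type*} {l : Filter α} {N : α → ℕ} {β : α → C(I, E d)} {b : C(I, E d)}

theorem eventually_exists_gridPt (hN : Tendsto N l atTop) (t : I) {U : Set I} (hU : U ∈ 𝓝 t) :
    ∀ᶠ x in l, ∃ i : Fin (N x), gridPt (N x) i ∈ U := by
  obtain ⟨r, hr, hrU⟩ := Metric.mem_nhds_iff.1 hU
  have h1 : Tendsto (fun x => 1 / (N x : ℝ)) l (𝓝 0) :=
    tendsto_one_div_atTop_nhds_zero_nat.comp hN
  filter_upwards [h1.eventually (gt_mem_nhds hr), hN.eventually_gt_atTop 0] with x hx h0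
  obtain ⟨i, hi⟩ := exists_gridPt_near h0 t
  exact ⟨i, hrU (hi.trans_lt hx)⟩

/-- For a fixed direction, a negative pairing persists for nearby directions, paths and times, and
fine grids contain such times. Compactness of the sphere leaves finitely many margins, whose minimum
works. -/
theorem eventually_halfspace (hw : Continuous fun t : I => w t) (hN : Tendsto N l atTop)
    (hβ : Tendsto β l (𝓝 b)) (hb : ∀ u : E d, u ≠ 0 → ∃ t, inner ℝ u (limitFwd w b t) < 0) :
    ∃ m > 0, ∀ᶠ x in l, ∀ u : E d, ‖u‖ = 1 →
      ∃ i, inner ℝ u (pathBlock w (β x) (N x) i) < -m := by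
  suffices h : ∃ m > 0, ∀ᶠ x in l, ∀ u ∈ Metric.sphere (0 : E d) 1,
      ∃ i, inner ℝ u (pathBlock w (β x) (N x) i) < -m by
    simpa using h
  refine (isCompact_sphere (0 : E d) 1).induction_on
    (p := fun s => ∃ m > 0, ∀ᶠ x in l, ∀ u ∈ s,
      ∃ i, inner ℝ u (pathBlock w (β x) (N x) i) < -m) ⟨1, one_pos, by simp⟩ ?_ ?_ ?_
  · rintro s s' hs ⟨m, hm, h⟩
    exact ⟨m, hm, h.mono fun x hx u hu => hx u (hs hu)⟩
  · rintro s s' ⟨m, hm, h⟩ ⟨m', hm', h'⟩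
    refine ⟨min m m', lt_min hm hm', ?_⟩
    filter_upwards [h, h'] with x hx hx' u hu
    rcases hu with hu | hu
    · obtain ⟨i, hi⟩ := hx u hu
      exact ⟨i, hi.trans_le (neg_le_neg (min_le_left _ _))⟩
    · obtain ⟨i, hi⟩ := hx' u hu
      exact ⟨i, hi.trans_le (neg_le_neg (min_le_right _ _))⟩
  · intro u₀ hu₀
    obtain ⟨t, ht⟩ := hb u₀ (by rintro rfl; simp at hu₀)
    set c := inner ℝ u₀ (limitFwd w b t) with hc
    have hcont : Continuous fun q : E d × (C(I, E d) × I) =>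
        (inner ℝ q.1 (limitFwd w q.2.1 q.2.2) : ℝ) :=
      continuous_fst.inner ((continuous_limitFwd hw).comp continuous_snd)
    have hev := hcont.continuousAt (x := (u₀, (b, t))) |>.eventually
      (gt_mem_nhds (show inner ℝ u₀ (limitFwd w b t) < c / 2 by rw [← hc]; linarith))
    rw [nhds_prod_eq, nhds_prod_eq, eventually_prod_iff] at hev
    obtain ⟨p, hp, q, hq, hpq⟩ := hev
    rw [eventually_prod_iff] at hq
    obtain ⟨p', hp', q', hq', hpq'⟩ := hq
    refine ⟨{u | p u}, mem_nhdsWithin_of_mem_nhds hp, -c / 2, by linarith, ?_⟩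
    filter_upwards [hβ.eventually hp', eventually_exists_gridPt hN t hq'] with x hx ⟨i, hi⟩ u hu
    exact ⟨Sum.inl i, (hpq hu (hpq' hx hi)).trans_eq (by ring)⟩

/-- A negative value of the limit would persist at nearby times and functions, hence at some grid
point. This puts limits of multipliers into `limitDomain`. -/
theorem forall_nonneg_of_tendsto {Φ : α → C(I, ℝ)} {φ : C(I, ℝ)} [l.NeBot]
    (hN : Tendsto N l atTop) (hΦ : Tendsto Φ l (𝓝 φ))
    (h : ∀ᶠ x in l, ∀ i, 0 ≤ Φ x (gridPt (N x) i)) (t : I) : 0 ≤ φ t := by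
  by_contra hlt
  have hcont : Continuous fun q : C(I, ℝ) × I => q.1 q.2 := by fun_prop
  have hev := hcont.continuousAt (x := (φ, t)) |>.eventually (gt_mem_nhds (not_le.1 hlt))
  rw [nhds_prod_eq, eventually_prod_iff] at hev
  obtain ⟨p, hp, q, hq, hpq⟩ := hev
  obtain ⟨x, hx, hx', ⟨i, hi⟩⟩ :=
    (h.and ((hΦ.eventually hp).and (eventually_exists_gridPt hN t hq))).exists
  exact absurd (hx i) (not_le.2 (hpq hx' hi))

theorem gridVal_eq (hw : Continuous fun t : I => w t) (b : C(I, E d)) (n : ℕ) (a : E d) :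
    gridVal w b n a = (1 / (n : ℝ)) * ∑ i, Real.log (slackFwd hw b a (gridPt n i)) +
      (1 / (n : ℝ)) * ∑ i, Real.log (slackBwd hw b a (gridPt n i)) := by
  rw [gridVal, Fintype.sum_sum_type, mul_add]
  rfl

/-- The truncated log-likelihood ratio of the block sums. -/
noncomputable def gridTrunc (hw : Continuous fun t : I => w t) (b : C(I, E d)) (n : ℕ) (a : E d)
    (ε : ℝ) (hε : 0 < ε) : ℝ :=
  (1 / (n : ℝ)) * ∑ i, truncLog ε hε (slackFwd hw b a (gridPt n i)) +
    (1 / (n : ℝ)) * ∑ i, truncLog ε hε (slackBwd hw b a (gridPt n i))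

theorem tendsto_uncurried {A B C : Type*} [TopologicalSpace A] [TopologicalSpace B]
    [TopologicalSpace C] {F : A × B → C} (hF : Continuous F) {u : α → A} {v : α → B} {p : A} {q : B}
    (hu : Tendsto u l (𝓝 p)) (hv : Tendsto v l (𝓝 q)) :
    Tendsto (fun x => F (u x, v x)) l (𝓝 (F (p, q))) :=
  (hF.tendsto (p, q)).comp (hu.prodMk_nhds hv)

theorem tendsto_slackFwd (hw : Continuous fun t : I => w t) (hβ : Tendsto β l (𝓝 b)) {y : α → E d}
    {a : E d} (hy : Tendsto y l (𝓝 a)) :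
    Tendsto (fun x => slackFwd hw (β x) (y x)) l (𝓝 (slackFwd hw b a)) :=
  tendsto_uncurried (continuous_slackFwd hw) hβ hy

theorem tendsto_slackBwd (hw : Continuous fun t : I => w t) (hβ : Tendsto β l (𝓝 b)) {y : α → E d}
    {a : E d} (hy : Tendsto y l (𝓝 a)) :
    Tendsto (fun x => slackBwd hw (β x) (y x)) l (𝓝 (slackBwd hw b a)) :=
  tendsto_uncurried (continuous_slackBwd hw) hβ hy

theorem tendsto_gridTrunc (hw : Continuous fun t : I => w t) (hN : Tendsto N l atTop)
    (hβ : Tendsto β l (𝓝 b)) {y : α → E d} {a : E d} (hy : Tendsto y l (𝓝 a)) {ε : ℝ}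
    (hε : 0 < ε) :
    Tendsto (fun x => gridTrunc hw (β x) (N x) (y x) ε hε) l (𝓝 (truncVal hw b a ε hε)) := by
  have h1 : Tendsto (fun x => (truncLog ε hε).comp (slackFwd hw (β x) (y x))) l
      (𝓝 ((truncLog ε hε).comp (slackFwd hw b a))) :=
    ((truncLog ε hε).continuous_postcomp.tendsto _).comp (tendsto_slackFwd hw hβ hy)
  have h2 : Tendsto (fun x => (truncLog ε hε).comp (slackBwd hw (β x) (y x))) l
      (𝓝 ((truncLog ε hε).comp (slackBwd hw b a))) :=
    ((truncLog ε hε).continuous_postcomp.tendsto _).comp (tendsto_slackBwd hw hβ hy)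
  exact (tendsto_riemannSum_of_tendsto hN h1).add (tendsto_riemannSum_of_tendsto hN h2)

theorem gridVal_le_gridTrunc (hw : Continuous fun t : I => w t) {b : C(I, E d)} {n : ℕ} {a : E d}
    (h : ∀ i, 0 < 1 + inner ℝ a (pathBlock w b n i)) {ε : ℝ} (hε : 0 < ε) :
    gridVal w b n a ≤ gridTrunc hw b n a ε hε := by
  rw [gridVal_eq hw, gridTrunc]
  refine add_le_add (mul_le_mul_of_nonneg_left (Finset.sum_le_sum fun i _ => ?_) (by positivity))
    (mul_le_mul_of_nonneg_left (Finset.sum_le_sum fun i _ => ?_) (by positivity))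
  · exact Real.log_le_log (h (Sum.inl i)) (le_max_right _ _)
  · exact Real.log_le_log (h (Sum.inr i)) (le_max_right _ _)

/-- Multipliers do asymptotically at least as well as any interior point of the limiting domain. -/
theorem eventually_gridTrunc_le (hw : Continuous fun t : I => w t)
    (hβ : Tendsto β l (𝓝 b)) {y : α → E d}
    (hy : ∀ᶠ x in l, IsMultiplier (pathBlock w (β x) (N x)) (y x)) {a : E d} {δ : ℝ} (hδ : 0 < δ)
    (h1 : ∀ t, 2 * δ ≤ slackFwd hw b a t) (h2 : ∀ t, 2 * δ ≤ slackBwd hw b a t) :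
    ∀ᶠ x in l, gridTrunc hw (β x) (N x) a δ hδ ≤ gridVal w (β x) (N x) (y x) := by
  have t1 : Tendsto (fun x => slackFwd hw (β x) a) l (𝓝 (slackFwd hw b a)) :=
    tendsto_slackFwd hw hβ tendsto_const_nhds
  have t2 : Tendsto (fun x => slackBwd hw (β x) a) l (𝓝 (slackBwd hw b a)) :=
    tendsto_slackBwd hw hβ tendsto_const_nhds
  -- Half of the slack `2 * δ` absorbs the perturbation of the path, so that truncation at `δ`
  -- changes nothing at `a`.
  have key : ∀ {φ ψ : C(I, ℝ)}, (∀ t, 2 * δ ≤ ψ t) → dist φ ψ < δ → ∀ t, δ ≤ φ t := by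
    intro φ ψ h hd t
    have := (abs_lt.1 ((Real.dist_eq _ _).symm.trans_lt
      ((ContinuousMap.dist_apply_le_dist t).trans_lt hd))).1
    linarith [h t]
  filter_upwards [hy, t1.eventually (Metric.ball_mem_nhds _ hδ),
    t2.eventually (Metric.ball_mem_nhds _ hδ)] with x hx d1 d2
  have g1 := key h1 d1
  have g2 := key h2 d2
  have hpos : ∀ i, 0 < 1 + inner ℝ a (pathBlock w (β x) (N x) i) := by
    rintro (i | i)
    · exact hδ.trans_le (g1 (gridPt (N x) i))
    · exact hδ.trans_le (g2 (gridPt (N x) i))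
  calc gridTrunc hw (β x) (N x) a δ hδ = gridVal w (β x) (N x) a := by
        rw [gridTrunc, gridVal_eq hw]
        congr 2 <;> refine Finset.sum_congr rfl fun i _ => ?_
        · exact congrArg Real.log (max_eq_right (g1 _))
        · exact congrArg Real.log (max_eq_right (g2 _))
    _ ≤ _ := mul_le_mul_of_nonneg_left (hx.sum_log_le hpos) (by positivity)

/-- Concavity along the ray from `0`. The level `(1 - s) / 2` is half the available slack, as
`eventually_gridTrunc_le` requires. -/
theorem logVal_mul_le_truncVal (hw : Continuous fun t : I => w t) {a : E d}
    (ha : a ∈ limitDomain w b) (hf : limitObj w b a ≠ ⊤) {s : ℝ} (hs : s ∈ Set.Ioo (0 : ℝ) 1) :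
    s * logVal hw b a ≤ truncVal hw b (s • a) ((1 - s) / 2) (half_pos (sub_pos.2 hs.2)) := by
  obtain ⟨h1, h2, -⟩ := limitDomain_smul hw ha hs
  have hs1 := hs.2
  have hle := limitObj_smul_le hw ha hf hs
  rw [limitObj_eq_truncVal hw (half_pos (sub_pos.2 hs.2)) (fun t => le_trans (by linarith) (h1 t))
    (fun t => le_trans (by linarith) (h2 t)), EReal.coe_le_coe_iff] at hle
  linarith

/-- Limits of multipliers minimize the limiting objective. -/
theorem isMin_of_tendsto (hw : Continuous fun t : I => w t) [l.NeBot] (hN : Tendsto N l atTop)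
    (hβ : Tendsto β l (𝓝 b)) {y : α → E d}
    (hy : ∀ᶠ x in l, IsMultiplier (pathBlock w (β x) (N x)) (y x)) {z : E d}
    (hz : Tendsto y l (𝓝 z)) :
    z ∈ limitDomain w b ∧ ∀ a ∈ limitDomain w b, limitObj w b z ≤ limitObj w b a := by
  have hzd : z ∈ limitDomain w b := by
    refine ⟨forall_nonneg_of_tendsto (φ := slackFwd hw b z) hN
      (tendsto_slackFwd hw hβ hz) ?_,
      forall_nonneg_of_tendsto (φ := slackBwd hw b z) hN
      (tendsto_slackBwd hw hβ hz) ?_⟩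
    · exact hy.mono fun x hx i => (hx.1 (Sum.inl i)).le
    · exact hy.mono fun x hx i => (hx.1 (Sum.inr i)).le
  refine ⟨hzd, fun a ha => ?_⟩
  by_cases hat : limitObj w b a = ⊤
  · rw [hat]; exact le_top
  -- With `s` and the truncation at `z` fixed, pass to the limit along `l`; then remove the
  -- truncation, and only afterwards let `s → 1`.
  have hs : ∀ s ∈ Set.Ioo (0 : ℝ) 1, limitObj w b z ≤ ((-(s * logVal hw b a) : ℝ) : EReal) := by
    intro s hs
    obtain ⟨h1, h2, -⟩ := limitDomain_smul hw ha hs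
    refine le_of_tendsto' (tendsto_truncVal hw hzd) fun k => EReal.coe_le_coe_iff.2 (neg_le_neg ?_)
    refine (logVal_mul_le_truncVal hw ha hat hs).trans ?_
    refine le_of_tendsto_of_tendsto (tendsto_gridTrunc hw hN hβ tendsto_const_nhds _)
      (tendsto_gridTrunc hw hN hβ hz _) ?_
    filter_upwards [hy, eventually_gridTrunc_le hw hβ hy (half_pos (sub_pos.2 hs.2))
      (fun t => le_trans (by linarith) (h1 t)) (fun t => le_trans (by linarith) (h2 t))]
      with x hx hx'
    exact hx'.trans (gridVal_le_gridTrunc hw hx.1 _)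
  rw [(limitObj_of_ne_top hw ha hat).2.2]
  have hlim : Tendsto (fun s : ℝ => ((-(s * logVal hw b a) : ℝ) : EReal)) (𝓝[<] 1)
      (𝓝 ((-(1 * logVal hw b a) : ℝ) : EReal)) := by
    refine (Continuous.tendsto ?_ 1).mono_left nhdsWithin_le_nhds
    exact continuous_coe_real_ereal.comp (by fun_prop)
  rw [one_mul] at hlim
  exact ge_of_tendsto hlim (by
    filter_upwards [Ioo_mem_nhdsLT (zero_lt_one' ℝ)] with s h using hs s h)

/-- The multipliers eventually exist and are bounded. -/
theorem eventually_existsUnique (hw : Continuous fun t : I => w t) (hN : Tendsto N l atTop)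
    (hβ : Tendsto β l (𝓝 b)) (hb : ∀ u : E d, u ≠ 0 → ∃ t, inner ℝ u (limitFwd w b t) < 0) :
    ∃ R, ∀ᶠ x in l, (∃! y, IsMultiplier (pathBlock w (β x) (N x)) y) ∧
      ‖multiplier (pathBlock w (β x) (N x))‖ ≤ R := by
  obtain ⟨m, hm, h⟩ := eventually_halfspace hw hN hβ hb
  refine ⟨1 / m, h.mono fun x hx => ?_⟩
  have hex := existsUnique_isMultiplier hm hx
  refine ⟨hex, ?_⟩
  rw [le_div_iff₀ hm, mul_comm]
  exact norm_le_of_halfspace hx fun i => ((isMultiplier_multiplier hex).1 i).le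

/-- Discretize the fixed path `b`: the bounded sequence of its grid multipliers has a cluster point,
and `isMin_of_tendsto` along an ultrafilter shows that this point is a minimizer. -/
theorem exists_isUniqueMinimizer (hw : Continuous fun t : I => w t)
    (hb : ∀ u : E d, u ≠ 0 → ∃ t, inner ℝ u (limitFwd w b t) < 0) :
    ∃ y, IsUniqueMinimizer w b y := by
  obtain ⟨R, hR⟩ := eventually_existsUnique hw tendsto_id (tendsto_const_nhds (x := b)) hb
  have hball : ∀ᶠ n : ℕ in atTop, multiplier (pathBlock w b n) ∈ Metric.closedBall (0 : E d) R :=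
    hR.mono fun n hn => mem_closedBall_zero_iff.2 hn.2
  obtain ⟨z, -, hz⟩ := (isCompact_closedBall (0 : E d) R).exists_mapClusterPt
    (tendsto_principal.2 hball)
  obtain ⟨U, hU, hUz⟩ := mapClusterPt_iff_ultrafilter.1 hz
  obtain ⟨h1, h2⟩ := isMin_of_tendsto (l := (U : Filter ℕ)) hw (N := id) hU
    (tendsto_const_nhds (x := b)) (y := fun n => multiplier (pathBlock w b n))
    (hU (hR.mono fun n hn => isMultiplier_multiplier hn.1)) hUz
  exact ⟨z, isUniqueMinimizer_of_forall_le hw hb h1 h2⟩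

/-- The multipliers are eventually in a compact ball and each of their cluster points is the unique
minimizer. The filter is kept general so that `atTop ×ˢ 𝓝 b` can be used for the mapping theorem. -/
theorem tendsto_multiplier (hw : Continuous fun t : I => w t) (hN : Tendsto N l atTop)
    (hβ : Tendsto β l (𝓝 b)) (hb : ∀ u : E d, u ≠ 0 → ∃ t, inner ℝ u (limitFwd w b t) < 0)
    {y : E d} (hy : IsUniqueMinimizer w b y) :
    Tendsto (fun x => multiplier (pathBlock w (β x) (N x))) l (𝓝 y) := by
  obtain ⟨R, hR⟩ := eventually_existsUnique hw hN hβ hb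
  refine (isCompact_closedBall (0 : E d) R).tendsto_nhds_of_unique_mapClusterPt
    (hR.mono fun x hx => mem_closedBall_zero_iff.2 hx.2) fun z _ hz => ?_
  obtain ⟨U, hU, hUz⟩ := mapClusterPt_iff_ultrafilter.1 hz
  obtain ⟨h1, h2⟩ := isMin_of_tendsto (l := (U : Filter α)) hw (hN.mono_left hU)
    (hβ.mono_left hU) (hU (hR.mono fun n hn => isMultiplier_multiplier hn.1)) hUz
  by_contra hne
  exact absurd (h2 y hy.1) (not_le.2 (hy.2 z h1 hne))

/-- The lower bound compares with the interior point `s • y`; the upper bound truncates the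
logarithm at the multipliers themselves, which converge to `y`. -/
theorem tendsto_gridVal (hw : Continuous fun t : I => w t) (hN : Tendsto N l atTop)
    (hβ : Tendsto β l (𝓝 b)) (hb : ∀ u : E d, u ≠ 0 → ∃ t, inner ℝ u (limitFwd w b t) < 0)
    {y : E d} (hy : IsUniqueMinimizer w b y) :
    Tendsto (fun x => gridVal w (β x) (N x) (multiplier (pathBlock w (β x) (N x)))) l
      (𝓝 (-limitObj w b y).toReal) := by
  obtain ⟨R, hR⟩ := eventually_existsUnique hw hN hβ hb
  have hmul : ∀ᶠ x in l, IsMultiplier (pathBlock w (β x) (N x))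
      (multiplier (pathBlock w (β x) (N x))) := hR.mono fun x hx => isMultiplier_multiplier hx.1
  have hyt := hy.ne_top hw
  have hV := (limitObj_of_ne_top hw hy.1 hyt).2.2
  set V := logVal hw b y with hVdef
  have htr := tendsto_truncVal hw hy.1
  rw [hV, EReal.tendsto_coe] at htr
  rw [hV, ← EReal.coe_neg, neg_neg, EReal.toReal_coe]
  refine tendsto_order.2 ⟨fun c hc => ?_, fun c hc => ?_⟩
  · have hlim : Tendsto (fun s : ℝ => s * V) (𝓝[<] 1) (𝓝 (1 * V)) :=
      (Continuous.tendsto (by fun_prop) 1).mono_left nhdsWithin_le_nhds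
    rw [one_mul] at hlim
    obtain ⟨s, hsc, hs⟩ := ((hlim.eventually (lt_mem_nhds hc)).and
      (Ioo_mem_nhdsLT (zero_lt_one' ℝ))).exists
    obtain ⟨h1, h2, -⟩ := limitDomain_smul hw hy.1 hs
    have hlt := hsc.trans_le (logVal_mul_le_truncVal hw hy.1 hyt hs)
    filter_upwards [eventually_gridTrunc_le hw hβ hmul (half_pos (sub_pos.2 hs.2))
      (fun t => le_trans (by linarith) (h1 t)) (fun t => le_trans (by linarith) (h2 t)),
      (tendsto_gridTrunc hw hN hβ (tendsto_const_nhds (x := s • y))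
        (half_pos (sub_pos.2 hs.2))).eventually (lt_mem_nhds hlt)] with x hx hx'
    exact hx'.trans_le hx
  · have htr' := htr.neg
    simp only [neg_neg] at htr'
    obtain ⟨k, hk⟩ := (htr'.eventually (gt_mem_nhds hc)).exists
    filter_upwards [hmul, (tendsto_gridTrunc hw hN hβ (tendsto_multiplier hw hN hβ hb hy)
      Nat.one_div_pos_of_nat).eventually (gt_mem_nhds hk)] with x hx hx'
    exact (gridVal_le_gridTrunc hw hx.1 _).trans_lt hx'

end Deterministic

/-! ### The extended continuous mapping theorem -/

section Mapping

variable {Ω Ω' C : Type*} [MeasurableSpace Ω] {P : Measure Ω} [IsProbabilityMeasure P]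
  [MeasurableSpace Ω'] {P' : Measure Ω'} [IsProbabilityMeasure P']
  [TopologicalSpace C] [MeasurableSpace C] [OpensMeasurableSpace C] [HasOuterApproxClosed C]
  {X : ℕ → Ω → C} {Z : Ω' → C}

/-- The portmanteau inequality for a sequence of sets. -/
theorem limsup_measure_le_of_eventually (h : TendstoInDistribution X atTop Z (fun _ => P) P')
    {A : ℕ → Set C} {A' : Set Ω'}
    (hA : ∀ᵐ ω ∂P', ω ∉ A' → ∀ᶠ q : ℕ × C in atTop ×ˢ 𝓝 (Z ω), q.2 ∉ A q.1) :
    limsup (fun n => P {ω | X n ω ∈ A n}) atTop ≤ P' A' := by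
  -- The ordinary portmanteau inequality applies to each of these decreasing closed sets. Their
  -- intersection contains `Z ω` only if sets `A m` of arbitrarily large index come arbitrarily
  -- close to `Z ω`.
  set F : ℕ → Set C := fun k => closure (⋃ m ≥ k, A m) with hF
  have hFc : ∀ k, IsClosed (F k) := fun k => isClosed_closure
  have hFanti : Antitone F := fun k k' hk => closure_mono
    (Set.iUnion₂_subset fun m hm => Set.subset_iUnion₂_of_subset m (hk.trans hm) le_rfl)
  have hAF : ∀ k, ∀ n ≥ k, A n ⊆ F k := fun k n hn =>
    (Set.subset_iUnion₂ (s := fun m (_ : m ≥ k) => A m) n hn).trans subset_closure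
  have h1 : ∀ k, limsup (fun n => P {ω | X n ω ∈ A n}) atTop ≤ P' (Z ⁻¹' F k) := by
    intro k
    have hp := ProbabilityMeasure.limsup_measure_closed_le_of_tendsto h.tendsto (hFc k)
    simp only [ProbabilityMeasure.coe_mk] at hp
    rw [Measure.map_apply_of_aemeasurable h.aemeasurable_limit (hFc k).measurableSet] at hp
    refine le_trans (limsup_le_limsup ?_) hp
    filter_upwards [eventually_ge_atTop k] with n hn
    rw [Measure.map_apply_of_aemeasurable (h.forall_aemeasurable n) (hFc k).measurableSet]
    exact measure_mono fun ω hω => hAF k n hn hω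
  have h2 : Tendsto (fun k => P' (Z ⁻¹' F k)) atTop (𝓝 (P' (⋂ k, Z ⁻¹' F k))) :=
    tendsto_measure_iInter_atTop
      (fun k => h.aemeasurable_limit.nullMeasurableSet_preimage (hFc k).measurableSet)
      (fun k k' hk => Set.preimage_mono (hFanti hk)) ⟨0, measure_ne_top _ _⟩
  refine (ge_of_tendsto' h2 h1).trans (measure_mono_ae ?_)
  filter_upwards [hA] with ω hω hmem
  by_contra hA'
  have hev := hω hA'
  rw [eventually_prod_iff] at hev
  obtain ⟨p, hp, q, hq, hpq⟩ := hev
  obtain ⟨k, hk⟩ := eventually_atTop.1 hp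
  have hcl : Z ω ∈ closure (⋃ m ≥ k, A m) := Set.mem_iInter.1 hmem k
  obtain ⟨x, hx, hxA⟩ := mem_closure_iff_nhds.1 hcl _ hq
  obtain ⟨m, hm, hxm⟩ := Set.mem_iUnion₂.1 hxA
  exact hpq (hk m hm) hx hxm

theorem tendsto_measure_one_of_eventually (h : TendstoInDistribution X atTop Z (fun _ => P) P')
    {D : ℕ → Set C} (hD : ∀ᵐ ω ∂P', ∀ᶠ q : ℕ × C in atTop ×ˢ 𝓝 (Z ω), q.2 ∈ D q.1) :
    Tendsto (fun n => P {ω | X n ω ∈ D n}) atTop (𝓝 1) := by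
  have h0 := limsup_measure_le_of_eventually h (A := fun n => (D n)ᶜ) (A' := ∅)
    (hD.mono fun ω hω _ => hω.mono fun q hq => by simpa using hq)
  rw [measure_empty] at h0
  have h1 : Tendsto (fun n => P {ω | X n ω ∈ (D n)ᶜ}) atTop (𝓝 0) :=
    tendsto_of_le_liminf_of_limsup_le bot_le h0
  have h2 : Tendsto (fun n => 1 - P {ω | X n ω ∈ (D n)ᶜ}) atTop (𝓝 (1 - 0)) :=
    ENNReal.Tendsto.sub tendsto_const_nhds h1 (Or.inl ENNReal.one_ne_top)
  rw [tsub_zero] at h2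
  refine tendsto_of_tendsto_of_tendsto_of_le_of_le h2 tendsto_const_nhds (fun n => ?_)
    fun n => prob_le_one
  rw [tsub_le_iff_right, ← measure_univ (μ := P)]
  refine le_trans (measure_mono fun ω _ => ?_) (measure_union_le _ _)
  exact em _

/-- **Extended continuous mapping theorem**: the maps may depend on `n`. -/
theorem tendstoInDistribution_map {F : Type*} [TopologicalSpace F] [MeasurableSpace F]
    [OpensMeasurableSpace F] [HasOuterApproxClosed F]
    (h : TendstoInDistribution X atTop Z (fun _ => P) P') {Φ : ℕ → C → F} {V : Ω' → F}
    (hΦ : ∀ n, AEMeasurable (fun ω => Φ n (X n ω)) P) (hV : AEMeasurable V P')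
    (hlim : ∀ᵐ ω ∂P', Tendsto (fun q : ℕ × C => Φ q.1 q.2) (atTop ×ˢ 𝓝 (Z ω)) (𝓝 (V ω))) :
    TendstoInDistribution (fun n ω => Φ n (X n ω)) atTop V (fun _ => P) P' where
  forall_aemeasurable := hΦ
  aemeasurable_limit := hV
  tendsto := by
    refine tendsto_of_forall_isClosed_limsup_le' fun S hS => ?_
    simp only [ProbabilityMeasure.coe_mk]
    rw [Measure.map_apply_of_aemeasurable hV hS.measurableSet]
    simp only [fun n => Measure.map_apply_of_aemeasurable (hΦ n) hS.measurableSet]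
    refine limsup_measure_le_of_eventually h (A := fun n => Φ n ⁻¹' S) (A' := V ⁻¹' S) ?_
    filter_upwards [hlim] with ω hω hωS
    exact hω.eventually (hS.isOpen_compl.mem_nhds hωS)

end Mapping

/-! ### Brownian paths enter every orthant immediately -/

/-- Independent increments are formulated along finite increasing times; each finite stretch of a
decreasing sequence is reversed. -/
theorem HasIndepIncrements.nat_antitone {T Ω : Type*} [Preorder T] {mΩ : MeasurableSpace Ω}
    {P : Measure Ω} {X : T → Ω → ℝ} (hX : HasIndepIncrements X P) {t : ℕ → T} (ht : Antitone t) :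
    iIndepFun (fun i ω => X (t i) ω - X (t (i + 1)) ω) P := by
  refine iIndepFun_iff_finset.2 fun s => ?_
  set n := s.sup id + 1 with hn
  have hs : ∀ k : s, (k : ℕ) < n := fun k => Nat.lt_succ_of_le (Finset.le_sup (f := id) k.2)
  set g : s → Fin n := fun k => ⟨n - 1 - k, by have := hs k; omega⟩ with hg
  have hginj : Function.Injective g := fun a b hab => by
    have h1 := hs a
    have h2 := hs b
    have h3 : n - 1 - (a : ℕ) = n - 1 - b := congrArg Fin.val hab
    exact Subtype.ext (by omega)
  have hmono : Monotone fun j : Fin (n + 1) => t (n - j) := fun i j hij =>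
    ht (Nat.sub_le_sub_left hij n)
  have := (hX n _ hmono).precomp hginj
  convert this using 1
  funext k ω
  have h1 := hs k
  have e1 : n - ((g k).succ : ℕ) = k := by
    change n - (n - 1 - (k : ℕ) + 1) = k
    omega
  have e2 : n - ((g k).castSucc : ℕ) = k + 1 := by
    change n - (n - 1 - (k : ℕ)) = k + 1
    omega
  simp only [e1, e2, Finset.restrict]

theorem IsStdBrownian.hasLaw {Ω : Type*} [MeasurableSpace Ω] {P : Measure Ω} {W : I → Ω → ℝ}
    (hW : IsStdBrownian W P) (t : I) : HasLaw (W t) (gaussianReal 0 (t : ℝ).toNNReal) P := by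
  have h := hW.law 0 t t.2.1
  simp only [Set.Icc.coe_zero, sub_zero] at h
  refine h.congr ?_
  filter_upwards [hW.zero] with ω hω
  rw [hω, sub_zero]

theorem IsStdBrownian.variance_eq {Ω : Type*} [MeasurableSpace Ω] {P : Measure Ω} {W : I → Ω → ℝ}
    (hW : IsStdBrownian W P) (t : I) : Var[W t; P] = t := by
  rw [(hW.hasLaw t).variance_eq, variance_id_gaussianReal, Real.coe_toNNReal _ t.2.1]

theorem IsStdBrownian.integral_eq {Ω : Type*} [MeasurableSpace Ω] {P : Measure Ω} {W : I → Ω → ℝ}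
    (hW : IsStdBrownian W P) (t : I) : ∫ ω, W t ω ∂P = 0 := by
  rw [(hW.hasLaw t).integral_eq, integral_id_gaussianReal]

theorem IsStdBrownian.memLp {Ω : Type*} [MeasurableSpace Ω] {P : Measure Ω} {W : I → Ω → ℝ}
    (hW : IsStdBrownian W P) (t : I) : MemLp (W t) 2 P :=
  (hW.hasLaw t).hasGaussianLaw.memLp_two

theorem gaussianReal_Ioi_pos (x : ℝ) : 0 < gaussianReal 0 1 (Set.Ioi x) := by
  refine pos_iff_ne_zero.2 fun h => ?_
  have := gaussianReal_absolutelyContinuous' 0 one_ne_zero h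
  simp at this

/-- The threshold is at most `√2` standard deviations, so scaling gives a lower bound free of the
variance. -/
theorem gaussianReal_Ioi_ge {v x : ℝ} (hv : 0 < v) (hx : x ^ 2 ≤ 2 * v) :
    gaussianReal 0 1 (Set.Ioi √2) ≤ gaussianReal 0 v.toNNReal (Set.Ioi x) := by
  have hmap := gaussianReal_map_const_mul (μ := 0) (v := 1) √v
  have e : (NNReal.mk (√v ^ 2) (sq_nonneg _)) * 1 = v.toNNReal := by
    rw [mul_one]
    apply NNReal.coe_injective
    change √v ^ 2 = _
    rw [Real.sq_sqrt hv.le, Real.coe_toNNReal _ hv.le]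
  rw [mul_zero, e] at hmap
  rw [← hmap, Measure.map_apply (by fun_prop) measurableSet_Ioi]
  refine measure_mono fun z hz => ?_
  change x < √v * z
  have h1 : x ≤ √v * √2 := by
    rw [← Real.sqrt_mul hv.le, mul_comm]
    exact Real.le_sqrt_of_sq_le hx
  exact h1.trans_lt (mul_lt_mul_of_pos_left hz (Real.sqrt_pos.2 hv))

section Orthant

variable {d : ℕ} {Ω : Type*} [MeasurableSpace Ω] {P : Measure Ω} [IsProbabilityMeasure P]
  {B : Ω → C(I, E d)}

/-- The times `(c/2) 2^{-k²}`. -/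
noncomputable def fastTime (c : Set.Ioc (0 : ℝ) 1) (k : ℕ) : I :=
  ⟨(c : ℝ) / 2 * (1 / 2) ^ (k ^ 2), by have := c.2.1; positivity, by
    have h1 := c.2.1
    have h2 := c.2.2
    have h3 : ((1 : ℝ) / 2) ^ (k ^ 2) ≤ 1 := pow_le_one₀ (by norm_num) (by norm_num)
    nlinarith⟩

theorem fastTime_pos (c : Set.Ioc (0 : ℝ) 1) (k : ℕ) : 0 < (fastTime c k : ℝ) := by
  have := c.2.1
  change 0 < (c : ℝ) / 2 * (1 / 2) ^ (k ^ 2)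
  positivity

theorem fastTime_lt (c : Set.Ioc (0 : ℝ) 1) (k : ℕ) : (fastTime c k : ℝ) < c := by
  have h1 := c.2.1
  have h3 : ((1 : ℝ) / 2) ^ (k ^ 2) ≤ 1 := pow_le_one₀ (by norm_num) (by norm_num)
  change (c : ℝ) / 2 * (1 / 2) ^ (k ^ 2) < c
  nlinarith

theorem fastTime_succ (c : Set.Ioc (0 : ℝ) 1) (k : ℕ) :
    (fastTime c (k + 1) : ℝ) = fastTime c k * (1 / 2) ^ (2 * k + 1) := by
  change (c : ℝ) / 2 * (1 / 2) ^ ((k + 1) ^ 2) = (c : ℝ) / 2 * (1 / 2) ^ (k ^ 2) * _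
  rw [mul_assoc, ← pow_add]
  congr 2
  ring

theorem fastTime_succ_le (c : Set.Ioc (0 : ℝ) 1) (k : ℕ) :
    (fastTime c (k + 1) : ℝ) ≤ fastTime c k / 2 := by
  rw [fastTime_succ, pow_succ]
  have h3 : ((1 : ℝ) / 2) ^ (2 * k) ≤ 1 := pow_le_one₀ (by norm_num) (by norm_num)
  have := fastTime_pos c k
  nlinarith

theorem antitone_fastTime (c : Set.Ioc (0 : ℝ) 1) : Antitone (fastTime c) :=
  antitone_nat_of_succ_le fun k => Subtype.coe_le_coe.1 <|
    (fastTime_succ_le c k).trans (half_le_self (fastTime_pos c k).le)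

theorem measurable_coord (hB : Measurable B) (t : I) (i : Fin d) :
    Measurable fun ω => B ω t i := by
  have h1 : Continuous fun b : C(I, E d) => b t i := by fun_prop
  exact h1.measurable.comp hB

/-- Almost surely a Brownian path visits a given open orthant at arbitrarily small times. -/
theorem ae_exists_orthant (hB : IsStdBrownianVector B P) (c : Set.Ioc (0 : ℝ) 1) (sg : Fin d → ℤˣ) :
    ∀ᵐ ω ∂P, ∃ t : I, (t : ℝ) ∈ Set.Ioo (0 : ℝ) c ∧ ∀ i, 0 < ((sg i : ℤ) : ℝ) * B ω t i := by
  set τ := fastTime c with hτ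
  have hsg : ∀ i, (((sg i : ℤ) : ℝ)) ^ 2 = 1 := fun i => by
    rcases Int.units_eq_one_or (sg i) with h | h <;> simp [h]
  -- The signed increment over `[τ (k+1), τ k]` exceeds `√(τ k)`, enough to dominate the value at `τ
  -- (k+1)`.
  set A : Fin d → ℕ → Set (I → ℝ) := fun i k =>
    {x | √(τ k : ℝ) < ((sg i : ℤ) : ℝ) * (x (τ k) - x (τ (k + 1)))} with hA
  have hAm : ∀ i k, MeasurableSet (A i k) := fun i k =>
    measurableSet_lt measurable_const (by fun_prop)
  set path : Fin d → Ω → I → ℝ := fun i ω t => B ω t i with hpath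
  have hpm : ∀ i, Measurable (path i) := fun i =>
    measurable_pi_lambda _ fun t => measurable_coord hB.measurable t i
  set G : ℕ → Set Ω := fun k => ⋂ i ∈ Finset.univ, path i ⁻¹' A i k with hG
  have hGm : ∀ k, MeasurableSet (G k) := fun k =>
    Finset.measurableSet_biInter _ fun i _ => hpm i (hAm i k)
  have hPG : ∀ k, P (G k) = ∏ i, P (path i ⁻¹' A i k) := fun k =>
    hB.indep.measure_inter_preimage_eq_mul Finset.univ fun i _ => hAm i k
  -- Regroup the intersection by coordinates, use independence of the coordinates and then of the
  -- increments, and interchange the two products.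
  have hind : iIndepSet G P := by
    rw [iIndepSet_iff_meas_biInter hGm]
    intro s
    have e1 : ⋂ k ∈ s, G k = ⋂ i ∈ Finset.univ, path i ⁻¹' (⋂ k ∈ s, A i k) := by
      ext ω
      simp only [hG, Set.mem_iInter, Set.mem_preimage]
      exact ⟨fun h i hi k hk => h k hk i hi, fun h k hk i hi => h i hi k hk⟩
    rw [e1, hB.indep.measure_inter_preimage_eq_mul Finset.univ
      fun i _ => Finset.measurableSet_biInter _ fun k _ => hAm i k]
    simp only [hPG]
    rw [Finset.prod_comm]
    refine Finset.prod_congr rfl fun i _ => ?_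
    have h1 := HasIndepIncrements.nat_antitone (hB.coord i).indep (antitone_fastTime c)
    have h2 := h1.measure_inter_preimage_eq_mul s
      (sets := fun k => {x | √(τ k : ℝ) < ((sg i : ℤ) : ℝ) * x})
      fun k _ => measurableSet_lt measurable_const (by fun_prop)
    rw [Set.preimage_iInter₂]
    exact h2
  set p := gaussianReal 0 1 (Set.Ioi √2) with hp
  -- Since `τ (k+1) ≤ τ k / 2`, the increment has variance at least `τ k / 2`, so `√(τ k)` is at
  -- most `√2` standard deviations.
  have hPA : ∀ i k, p ≤ P (path i ⁻¹' A i k) := by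
    intro i k
    have h1 := fastTime_succ_le c k
    have h2 := fastTime_pos c k
    have hlaw := gaussianReal_const_mul ((hB.coord i).law (τ (k + 1)) (τ k)
      (antitone_fastTime c k.le_succ)) ((sg i : ℤ) : ℝ)
    have e : (NNReal.mk ((((sg i : ℤ) : ℝ)) ^ 2) (sq_nonneg _)) = 1 :=
      NNReal.coe_injective (hsg i)
    rw [mul_zero, e, one_mul] at hlaw
    refine (gaussianReal_Ioi_ge (v := (τ k : ℝ) - τ (k + 1)) (x := √(τ k : ℝ)) ?_ ?_).trans ?_
    · linarith
    · rw [Real.sq_sqrt h2.le]; linarith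
    · rw [← hlaw.map_eq, Measure.map_apply_of_aemeasurable hlaw.aemeasurable measurableSet_Ioi]
      exact le_rfl
  have hsum : ∑' k, P (G k) = ⊤ := by
    have hp0 : p ^ d ≠ 0 := pow_ne_zero _ (gaussianReal_Ioi_pos _).ne'
    refine top_le_iff.1 (le_of_eq_of_le
      (ENNReal.tsum_const_eq_top_of_ne_zero (α := ℕ) hp0).symm ?_)
    refine ENNReal.tsum_le_tsum fun k => ?_
    rw [hPG]
    calc p ^ d = ∏ _i : Fin d, p := by simp
      _ ≤ _ := Finset.prod_le_prod' fun i _ => hPA i k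
  have hfreq : ∀ᵐ ω ∂P, ∃ᶠ k in atTop, ω ∈ G k := by
    have h1 := (mem_ae_iff_prob_eq_one (MeasurableSet.measurableSet_limsup hGm)).2
      (measure_limsup_eq_one hGm hind hsum)
    filter_upwards [h1] with ω hω using mem_limsup_iff_frequently_mem.1 hω
  -- Chebyshev's inequality bounds the exceptional probabilities by `τ (k+1) / τ k = 2^{-(2k+1)}`.
  -- The exponent `k²` in the times makes these summable, and the first Borel–Cantelli lemma
  -- applies.
  have hsmall : ∀ i, ∀ᵐ ω ∂P, ∀ᶠ k in atTop, |B ω (τ (k + 1)) i| < √(τ k : ℝ) := by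
    intro i
    have hbd : ∀ k, P {ω | √(τ k : ℝ) ≤ |B ω (τ (k + 1)) i|} ≤
        ENNReal.ofReal ((1 / 2) ^ (2 * k + 1)) := by
      intro k
      have hc := meas_ge_le_variance_div_sq ((hB.coord i).memLp (τ (k + 1)))
        (Real.sqrt_pos.2 (fastTime_pos c k))
      rw [(hB.coord i).integral_eq, (hB.coord i).variance_eq,
        Real.sq_sqrt (fastTime_pos c k).le] at hc
      simp only [sub_zero] at hc
      refine hc.trans (ENNReal.ofReal_le_ofReal (le_of_eq ?_))
      rw [fastTime_succ, mul_div_cancel_left₀ _ (fastTime_pos c k).ne']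
    have hfin : ∑' k, P {ω | √(τ k : ℝ) ≤ |B ω (τ (k + 1)) i|} ≠ ⊤ := by
      refine ne_top_of_le_ne_top ?_ (ENNReal.tsum_le_tsum hbd)
      have hs : Summable fun k : ℕ => ((1 : ℝ) / 2) ^ (2 * k + 1) :=
        (summable_geometric_of_lt_one (by norm_num) (by norm_num)).comp_injective
          (i := fun k => 2 * k + 1) fun a b h => by simpa using h
      exact hs.tsum_ofReal_ne_top
    filter_upwards [ae_eventually_notMem hfin] with ω hω
    exact hω.mono fun k hk => not_le.1 hk
  filter_upwards [hfreq, ae_all_iff.2 hsmall] with ω h1 h2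
  obtain ⟨k, hk, hk'⟩ := (h1.and_eventually (eventually_all.2 h2)).exists
  refine ⟨τ k, ⟨fastTime_pos c k, fastTime_lt c k⟩, fun i => ?_⟩
  have h3 : √(τ k : ℝ) < ((sg i : ℤ) : ℝ) * (B ω (τ k) i - B ω (τ (k + 1)) i) :=
    Set.mem_iInter₂.1 hk i (Finset.mem_univ i)
  have h4 : |((sg i : ℤ) : ℝ) * B ω (τ (k + 1)) i| < √(τ k : ℝ) := by
    have : |((sg i : ℤ) : ℝ)| = 1 := by
      rcases Int.units_eq_one_or (sg i) with h | h <;> simp [h]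
    rw [abs_mul, this, one_mul]
    exact hk' i
  have h5 := (abs_lt.1 h4).1
  rw [mul_sub] at h3
  linarith

/-- Almost surely the weighted Brownian path meets every open half-space. -/
theorem ae_forall_exists_inner_neg {w : ℝ → ℝ} (hw : IsWeight w) (hB : IsStdBrownianVector B P) :
    ∀ᵐ ω ∂P, ∀ u : E d, u ≠ 0 → ∃ t, inner ℝ u (limitFwd w (B ω) t) < 0 := by
  obtain ⟨c, hc, hpos⟩ := hw.pos
  have hall : ∀ᵐ ω ∂P, ∀ sg : Fin d → ℤˣ, ∃ t : I, (t : ℝ) ∈ Set.Ioo (0 : ℝ) c ∧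
      ∀ i, 0 < ((sg i : ℤ) : ℝ) * B ω t i :=
    ae_all_iff.2 fun sg => ae_exists_orthant hB ⟨c, hc⟩ sg
  filter_upwards [hall] with ω hω u hu
  -- In the orthant opposite to `u` every nonzero coordinate of `u` contributes a negative term.
  obtain ⟨t, ht, hsg⟩ := hω fun i => if 0 < u i then -1 else 1
  refine ⟨t, ?_⟩
  rw [limitFwd, real_inner_smul_right]
  refine mul_neg_of_pos_of_neg (hpos t ht) ?_
  rw [PiLp.inner_apply]
  have hterm : ∀ i, u i ≠ 0 → inner ℝ (u i) (B ω t i) < 0 := by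
    intro i hi
    have h := hsg i
    change B ω t i * u i < 0
    by_cases hui : 0 < u i
    · simp only [hui, if_true] at h
      push_cast at h
      exact mul_neg_of_neg_of_pos (by linarith) hui
    · simp only [hui, if_false] at h
      push_cast at h
      exact mul_neg_of_pos_of_neg (by linarith) (lt_of_le_of_ne (not_lt.1 hui) hi)
  have hex : ∃ i, u i ≠ 0 := by
    by_contra hno
    push Not at hno
    exact hu (by ext i; simpa using hno i)
  obtain ⟨i₀, hi₀⟩ := hex
  refine Finset.sum_neg' (fun i _ => ?_) ⟨i₀, Finset.mem_univ _, hterm i₀ hi₀⟩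
  rcases eq_or_ne (u i) 0 with h | h
  · simp [h]
  · exact (hterm i h).le

end Orthant

/-! ### Nondegeneracy of the weighted Brownian integral -/

/-- The density is at most `1 / √(2πv) ≤ 1 / s` whatever the mean, so the bound survives a limit of
Gaussians with variances bounded below. -/
theorem gaussianReal_Ioo_le {m s δ : ℝ} {v : NNReal} (hs : 0 < s) (hv : s ^ 2 ≤ v) :
    gaussianReal m v (Set.Ioo (-δ) δ) ≤ ENNReal.ofReal (s⁻¹ * (2 * δ)) := by
  have hv0 : (0 : ℝ) < v := (by positivity : 0 < s ^ 2).trans_le hv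
  rw [gaussianReal_apply _ (by exact_mod_cast hv0.ne')]
  calc ∫⁻ x in Set.Ioo (-δ) δ, gaussianPDF m v x ≤ ∫⁻ _ in Set.Ioo (-δ) δ, ENNReal.ofReal s⁻¹ := by
        refine lintegral_mono fun x => ENNReal.ofReal_le_ofReal ?_
        rw [gaussianPDFReal]
        refine (mul_le_of_le_one_right (by positivity) (Real.exp_le_one_iff.2 ?_)).trans ?_
        · exact div_nonpos_of_nonpos_of_nonneg (neg_nonpos.2 (sq_nonneg _)) (by positivity)
        · refine inv_anti₀ hs (Real.le_sqrt_of_sq_le (hv.trans ?_))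
          nlinarith [Real.pi_gt_three]
    _ = _ := by
        rw [setLIntegral_const, Real.volume_Ioo, ← ENNReal.ofReal_mul (by positivity)]
        congr 2
        ring

theorem IsStdBrownian.isGaussianProcess {Ω : Type*} [MeasurableSpace Ω] {P : Measure Ω}
    {W : I → Ω → ℝ} (hW : IsStdBrownian W P) :
    IsGaussianProcess W P :=
  hW.indep.isGaussianProcess (fun t => (hW.hasLaw t).hasGaussianLaw) hW.zero

section Weighted

variable {Ω : Type*} [MeasurableSpace Ω] {P : Measure Ω} [IsProbabilityMeasure P] {W : I → Ω → ℝ}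

theorem IsStdBrownian.covariance_one (hW : IsStdBrownian W P) (t : I) :
    cov[W t, W 1; P] = t := by
  have h := hW.indep.indepFun_eval_sub (show (0 : I) ≤ t from t.2.1) (show t ≤ 1 from t.2.2) hW.zero
  have e : W 1 = (W 1 - W t) + W t := by simp
  rw [e, covariance_add_right (hW.memLp t) ((hW.memLp 1).sub (hW.memLp t)) (hW.memLp t),
    h.covariance_eq_zero (hW.memLp t) ((hW.memLp 1).sub (hW.memLp t)),
    covariance_self (hW.memLp t).aemeasurable, hW.variance_eq, zero_add]

/-- The Riemann sum of `w(t) (W(t) + W(1) - W(1-t))`. -/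
noncomputable def weightedSum (w : ℝ → ℝ) (W : I → Ω → ℝ) (n : ℕ) (ω : Ω) : ℝ :=
  (1 / (n : ℝ)) * ∑ i, w (gridPt n i) *
    (W (gridPt n i) ω + W 1 ω - W (unitInterval.symm (gridPt n i)) ω)

/-- The covariance of `W t + W 1 - W (1 - t)` with `W 1` is `t + 1 - (1 - t) = 2t`. -/
theorem IsStdBrownian.weightedSum_law (hW : IsStdBrownian W P) (w : ℝ → ℝ) (n : ℕ) :
    HasGaussianLaw (weightedSum w W n) P ∧ cov[weightedSum w W n, W 1; P] =
      (1 / (n : ℝ)) * ∑ i, w (gridPt n i) * (2 * (gridPt n i : ℝ)) := by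
  set f : Fin n × Fin 3 → I := fun j =>
    ![gridPt n j.1, 1, unitInterval.symm (gridPt n j.1)] j.2 with hf
  set c : Fin n × Fin 3 → ℝ := fun j => (1 / (n : ℝ)) * (w (gridPt n j.1) * ![1, 1, -1] j.2) with hc
  have e : weightedSum w W n = fun ω => ∑ j, c j * W (f j) ω := by
    funext ω
    rw [weightedSum, Finset.mul_sum, Fintype.sum_prod_type]
    refine Finset.sum_congr rfl fun i _ => ?_
    simp [Fin.sum_univ_three, hf, hc]
    ring
  constructor
  · rw [e]
    exact ((hW.isGaussianProcess.comp_right f).smul c).hasGaussianLaw_fun_sum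
  · rw [e, covariance_fun_sum_left (fun j => (hW.memLp (f j)).const_mul (c j)) (hW.memLp 1)]
    simp only [covariance_const_mul_left, hW.covariance_one]
    rw [Finset.mul_sum, Fintype.sum_prod_type]
    refine Finset.sum_congr rfl fun i _ => ?_
    simp [Fin.sum_univ_three, hf, hc]
    ring

/-- Cauchy–Schwarz with `Var (W 1) = 1`. It turns the explicit covariance into a lower bound on the
variance, avoiding a computation of the latter. -/
theorem IsStdBrownian.sq_covariance_le (hW : IsStdBrownian W P) {Z : Ω → ℝ} (hZ : MemLp Z 2 P) :
    cov[Z, W 1; P] ^ 2 ≤ Var[Z; P] := by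
  set c := cov[Z, W 1; P] with hc
  have h := variance_nonneg (Z - c • W 1) P
  rw [variance_sub hZ ((hW.memLp 1).const_smul c), covariance_smul_right, variance_smul,
    hW.variance_eq, ← hc] at h
  simp only [Set.Icc.coe_one] at h
  nlinarith

/-- The weighted Brownian integral has no atom at `0`. -/
theorem IsStdBrownian.ae_integral_ne_zero {w : ℝ → ℝ} (hw : IsWeight w)
    (hwc : Continuous fun t : I => w t) (hW : IsStdBrownian W P)
    (hWc : ∀ ω, Continuous fun t => W t ω) :
    ∀ᵐ ω ∂P, ∫ t : I, w t * (W t ω + W 1 ω - W (unitInterval.symm t) ω) ≠ 0 := by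
  have hlim : ∀ ω, Tendsto (fun n => weightedSum w W n ω) atTop
      (𝓝 (∫ t : I, w t * (W t ω + W 1 ω - W (unitInterval.symm t) ω))) := fun ω => by
    have := hWc ω
    exact tendsto_riemannSum ⟨fun t : I => w t * (W t ω + W 1 ω - W (unitInterval.symm t) ω),
      hwc.mul ((this.add continuous_const).sub (this.comp unitInterval.continuous_symm))⟩
  set κ := ∫ t : I, w t * (2 * (t : ℝ)) with hκ
  have hcont : Continuous fun t : I => w t * (2 * (t : ℝ)) := hwc.mul (by fun_prop)
  have hκ0 : 0 < κ := by
    have hnn : ∀ t : I, 0 ≤ w t * (2 * (t : ℝ)) := fun t =>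
      mul_nonneg (hw.nonneg t t.2) (mul_nonneg two_pos.le t.2.1)
    rw [hκ, integral_pos_iff_support_of_nonneg hnn (integrable_of_compactSpace ⟨_, hcont⟩)]
    obtain ⟨c, hc, hpos⟩ := hw.pos
    have hc0 := hc.1
    have hc1 := hc.2
    have hopen : IsOpen {t : I | (t : ℝ) ∈ Set.Ioo 0 c} := isOpen_Ioo.preimage
      continuous_subtype_val
    refine (volume_pos_of_isOpen hopen ⟨⟨c / 2, by linarith, by linarith⟩, ?_⟩).trans_le
      (measure_mono fun t ht => ?_)
    · exact ⟨by change 0 < c / 2; linarith, by change c / 2 < c; linarith⟩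
    · exact (mul_pos (hpos t ht) (mul_pos two_pos ht.1)).ne'
  have hcov : Tendsto (fun n => cov[weightedSum w W n, W 1; P]) atTop (𝓝 κ) := by
    simp only [fun n => (hW.weightedSum_law w n).2]
    exact tendsto_riemannSum ⟨_, hcont⟩
  set s := κ / 2 with hs
  have hs0 : 0 < s := half_pos hκ0
  have hball : ∀ δ > 0, ∀ᶠ n in atTop, P {ω | weightedSum w W n ω ∈ Set.Ioo (-δ) δ} ≤
      ENNReal.ofReal (s⁻¹ * (2 * δ)) := by
    intro δ hδ
    filter_upwards [hcov.eventually (lt_mem_nhds (half_lt_self hκ0))] with n hn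
    have hg := (hW.weightedSum_law w n).1
    have hvar : s ^ 2 ≤ Var[weightedSum w W n; P] :=
      (pow_le_pow_left₀ hs0.le hn.le 2).trans (hW.sq_covariance_le hg.memLp_two)
    have := gaussianReal_Ioo_le (m := ∫ ω, weightedSum w W n ω ∂P)
      (v := Var[weightedSum w W n; P].toNNReal) hs0
      (hvar.trans_eq (Real.coe_toNNReal _ (variance_nonneg _ _)).symm) (δ := δ)
    rwa [← hg.map_eq_gaussianReal, Measure.map_apply_of_aemeasurable hg.aemeasurable
      measurableSet_Ioo] at this
  -- Where the integral vanishes, the weighted sums eventually lie in `(-δ, δ)`. Continuity of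
  -- measure along the increasing tail events transfers the small-ball bound without identifying the
  -- law of the limit.
  have hle : ∀ δ > 0, P {ω | ∫ t : I, w t * (W t ω + W 1 ω - W (unitInterval.symm t) ω) = 0} ≤
      ENNReal.ofReal (s⁻¹ * (2 * δ)) := by
    intro δ hδ
    have hsub : {ω | ∫ t : I, w t * (W t ω + W 1 ω - W (unitInterval.symm t) ω) = 0} ⊆
        ⋃ N : ℕ, ⋂ n ≥ N, {ω | weightedSum w W n ω ∈ Set.Ioo (-δ) δ} := by
      intro ω hω
      have h1 := hlim ω
      rw [show ∫ t : I, w t * (W t ω + W 1 ω - W (unitInterval.symm t) ω) = 0 from hω] at h1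
      obtain ⟨N, hN⟩ := eventually_atTop.1
        (h1.eventually (Ioo_mem_nhds (neg_lt_zero.2 hδ) hδ))
      exact Set.mem_iUnion.2 ⟨N, Set.mem_iInter₂.2 hN⟩
    have hmono : Monotone fun N : ℕ => ⋂ n ≥ N, {ω | weightedSum w W n ω ∈ Set.Ioo (-δ) δ} :=
      fun N N' h => Set.subset_iInter₂ fun n hn => Set.iInter₂_subset n (h.trans hn)
    refine (measure_mono hsub).trans ?_
    rw [hmono.measure_iUnion]
    refine iSup_le fun N => ?_
    obtain ⟨n, hn, hnN⟩ := ((hball δ hδ).and (eventually_ge_atTop N)).exists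
    exact (measure_mono (Set.iInter₂_subset n hnN)).trans hn
  rw [ae_iff]
  simp only [ne_eq, not_not]
  refine le_antisymm ?_ bot_le
  have ht : Tendsto (fun δ : ℝ => ENNReal.ofReal (s⁻¹ * (2 * δ))) (𝓝[>] 0) (𝓝 0) := by
    have : Continuous fun δ : ℝ => ENNReal.ofReal (s⁻¹ * (2 * δ)) :=
      ENNReal.continuous_ofReal.comp (by fun_prop)
    have h := this.tendsto 0
    simp only [mul_zero, ENNReal.ofReal_zero] at h
    exact h.mono_left nhdsWithin_le_nhds
  exact ge_of_tendsto ht (eventually_mem_nhdsWithin.mono hle)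

end Weighted

/-- Almost surely the limiting objective has a nonzero directional derivative at `0`. -/
theorem ae_exists_direction {d : ℕ} (hd : 0 < d) {Ω : Type*} [MeasurableSpace Ω] {P : Measure Ω}
    [IsProbabilityMeasure P] {B : Ω → C(I, E d)} {w : ℝ → ℝ} (hw : IsWeight w)
    (hwc : Continuous fun t : I => w t) (hB : IsStdBrownianVector B P) :
    ∀ᵐ ω ∂P, ∃ v : E d, 0 < (∫ t, inner ℝ v (limitFwd w (B ω) t)) +
      ∫ t, inner ℝ v (limitBwd w (B ω) t) := by
  set i₀ : Fin d := ⟨0, hd⟩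
  filter_upwards [(hB.coord i₀).ae_integral_ne_zero hw hwc fun ω => by fun_prop] with ω hω
  set z := ∫ t : I, w t * (B ω t i₀ + B ω 1 i₀ - B ω (unitInterval.symm t) i₀) with hz
  -- Along `z` times the basis vector the derivative is `z * z`, positive whatever the sign of `z`.
  refine ⟨EuclideanSpace.single i₀ z, ?_⟩
  have e1 : ∀ t, inner ℝ (EuclideanSpace.single i₀ z) (limitFwd w (B ω) t)
      = z * (w t * B ω t i₀) := fun t => by
    rw [EuclideanSpace.inner_single_left]
    simp [limitFwd]
  have e2 : ∀ t, inner ℝ (EuclideanSpace.single i₀ z) (limitBwd w (B ω) t)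
      = z * (w t * (B ω 1 i₀ - B ω (unitInterval.symm t) i₀)) := fun t => by
    rw [EuclideanSpace.inner_single_left]
    simp [limitBwd]
  have c1 : Continuous fun t : I => w t * B ω t i₀ := hwc.mul (by fun_prop)
  have c2 : Continuous fun t : I => w t * (B ω 1 i₀ - B ω (unitInterval.symm t) i₀) :=
    hwc.mul (by fun_prop)
  have e3 : z = (∫ t : I, w t * B ω t i₀) +
      ∫ t : I, w t * (B ω 1 i₀ - B ω (unitInterval.symm t) i₀) := by
    rw [hz]
    refine Eq.trans (integral_congr_ae (.of_forall fun t => ?_))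
      (integral_add (integrable_of_compactSpace ⟨_, c1⟩) (integrable_of_compactSpace ⟨_, c2⟩))
    change _ = w t * B ω t i₀ + w t * (B ω 1 i₀ - B ω (unitInterval.symm t) i₀)
    ring
  simp only [e1, e2]
  rw [integral_const_mul, integral_const_mul, ← mul_add, ← e3]
  exact mul_self_pos.2 hω

/-! ### The square root of the long-run covariance matrix -/

section Sqrt

variable {d : ℕ} {S : Matrix (Fin d) (Fin d) ℝ}

theorem inner_sqrtMap (x y : E d) : inner ℝ (sqrtMap S x) y = inner ℝ x (sqrtMap S y) := by
  have h : IsSelfAdjoint (CFC.sqrt S) := (CFC.sqrt_nonneg S).isSelfAdjoint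
  have h2 : IsSelfAdjoint (sqrtMap S) := h.map (Matrix.toEuclideanCLM (𝕜 := ℝ))
  exact h2.isSymmetric x y

theorem isUnit_sqrtMap (hS : S.PosDef) : IsUnit (sqrtMap S) := by
  have h1 : CFC.sqrt S * CFC.sqrt S = S := CFC.sqrt_mul_sqrt_self S hS.posSemidef.nonneg
  have h2 : IsUnit (CFC.sqrt S) := by
    rw [Matrix.isUnit_iff_isUnit_det]
    refine isUnit_of_mul_isUnit_left (y := (CFC.sqrt S).det) ?_
    rw [← Matrix.det_mul, h1]
    exact (Matrix.isUnit_iff_isUnit_det _).1 hS.isUnit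
  exact h2.map (Matrix.toEuclideanCLM (𝕜 := ℝ) (n := Fin d))

end Sqrt

/-! ### Block sums and the partial sum path -/

section Blocks

variable {d : ℕ} {x : ℤ → E d} {μ : E d}

theorem partialSumPath_div {n k : ℕ} (hn : 0 < n) (hk : k ≤ n) {t : I} (ht : (n : ℝ) * t = k) :
    partialSumPath x μ n t = ∑ j ∈ Finset.range k, (x ((j : ℤ) + 1) - μ) := by
  rcases k with _ | k
  · rw [partialSumPath_apply x μ hn t (by simp [ht]) (by simp [ht])]
    simp [ht]
  · push_cast at ht
    rw [partialSumPath_apply x μ (k := k) (by omega) t (by linarith) (by linarith), ht,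
      Finset.sum_range_succ]
    simp

theorem sum_Icc_one {M : Type*} [AddCommMonoid M] (f : ℕ → M) (m : ℕ) :
    ∑ j ∈ Finset.Icc 1 m, f j = ∑ j ∈ Finset.range m, f (j + 1) := by
  rw [← Finset.Ico_add_one_right_eq_Icc, Finset.sum_Ico_eq_sum_range]
  simp [add_comm]

/-- A backward block is the full sum minus the sum of the first `n - (i + 1)` terms, which is `b 1 -
b (1 - t)` at `t = (i + 1) / n` once `L` undoes the standardization. -/
theorem blockSum_eq {w : ℝ → ℝ} {n : ℕ} {L : E d →L[ℝ] E d} {b : C(I, E d)}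
    (hL : ∀ t, L (b t) = partialSumPath x μ n t) (i : Fin n ⊕ Fin n) :
    blockSum w x μ n i = L (pathBlock w b n i) := by
  rcases i with i | i
  · have hn : 0 < n := i.pos
    have hn' : (n : ℝ) ≠ 0 := by exact_mod_cast hn.ne'
    change _ • _ = L (w (gridPt n i) • b (gridPt n i))
    rw [map_smul, hL, partialSumPath_div (k := i + 1) hn i.2
      (by simp only [gridPt]; push_cast; field_simp), sum_Icc_one]
    simp [gridPt]
  · have hn : 0 < n := i.pos
    have hn' : (n : ℝ) ≠ 0 := by exact_mod_cast hn.ne'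
    change _ • _ = L (w (gridPt n i) • (b 1 - b (unitInterval.symm (gridPt n i))))
    have hi : (i : ℕ) + 1 ≤ n := i.2
    rw [map_smul, map_sub, hL, hL, partialSumPath_div (k := n) hn le_rfl (by simp),
      partialSumPath_div (k := n - (i + 1)) hn (Nat.sub_le _ _) (by
        rw [unitInterval.coe_symm_eq, Nat.cast_sub hi]
        simp only [gridPt]; push_cast; field_simp)]
    have e : ∑ j ∈ Finset.range n, (x ((j : ℤ) + 1) - μ)
        - ∑ j ∈ Finset.range (n - (i + 1)), (x ((j : ℤ) + 1) - μ)
        = ∑ j ∈ Finset.Icc 1 ((i : ℕ) + 1), (x ((n : ℤ) - (j : ℤ) + 1) - μ) := by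
      obtain ⟨m, hm⟩ := Nat.exists_eq_add_of_le' hi
      have hm' : n - (i + 1) = m := by omega
      rw [hm', sum_Icc_one]
      conv_lhs => rw [hm, Finset.sum_range_add, add_sub_cancel_left]
      rw [← Finset.sum_range_reflect]
      refine Finset.sum_congr rfl fun j hj => ?_
      have := Finset.mem_range.1 hj
      congr 2
      omega
    rw [e]
    rfl

end Blocks

/-! ### Measurability along random paths -/

section Measurability

variable {d : ℕ} {w : ℝ → ℝ}

theorem measurable_blockSum {Ω : Type*} [MeasurableSpace Ω] {X : ℤ → Ω → E d}
    (hX : ∀ t, Measurable (X t)) (w : ℝ → ℝ) (μ : E d) (n : ℕ) :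
    Measurable fun ω => blockSum w (fun t => X t ω) μ n := by
  refine measurable_pi_lambda _ fun i => ?_
  rcases i with i | i
  · change Measurable fun ω => w (((i : ℝ) + 1) / n) •
      ∑ j ∈ Finset.Icc 1 ((i : ℕ) + 1), (X (j : ℤ) ω - μ)
    exact Measurable.const_smul (Finset.measurable_fun_sum _ fun j _ => (hX _).sub_const μ)
      (w (((i : ℝ) + 1) / n))
  · change Measurable fun ω => w (((i : ℝ) + 1) / n) •
      ∑ j ∈ Finset.Icc 1 ((i : ℕ) + 1), (X ((n : ℤ) - (j : ℤ) + 1) ω - μ)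
    exact Measurable.const_smul (Finset.measurable_fun_sum _ fun j _ => (hX _).sub_const μ)
      (w (((i : ℝ) + 1) / n))

theorem measurable_pathBlock (hw : Continuous fun t : I => w t) (n : ℕ) :
    Measurable fun b : C(I, E d) => pathBlock w b n := by
  refine measurable_pi_lambda _ fun i => ?_
  rcases i with i | i
  · exact ((continuous_limitFwd hw).comp (continuous_id.prodMk continuous_const)).measurable
  · exact ((continuous_limitBwd hw).comp (continuous_id.prodMk continuous_const)).measurable

theorem measurable_gridVal (hw : Continuous fun t : I => w t) (n : ℕ) :
    Measurable fun b : C(I, E d) => gridVal w b n (multiplier (pathBlock w b n)) := by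
  have h := measurable_pathBlock (d := d) hw n
  refine Measurable.const_mul (Finset.measurable_fun_sum _ fun i _ => ?_) _
  refine ((measurable_const.add ?_)).log
  exact (measurable_multiplier.comp h).inner ((measurable_pi_apply i).comp h)

end Measurability

end EBEL

/-! ### Proof of the main theorem -/

open EBEL

theorem theorem4 {d : ℕ} (hd : 0 < d)
    -- the weight function
    (w : ℝ → ℝ) (hw : EBEL.IsWeight w)
    -- the strictly stationary process, its mean and its long-run covariance matrix
    {Ω : Type*} [MeasurableSpace Ω] (P : Measure Ω) [IsProbabilityMeasure P]
    (X : ℤ → Ω → EBEL.E d) (hX : EBEL.IsStrictlyStationary X P) (hX2 : MemLp (X 0) 2 P)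
    (μ₀ : EBEL.E d) (hμ₀ : ∫ ω, X 0 ω ∂P = μ₀)
    (S : Matrix (Fin d) (Fin d) ℝ) (hS : EBEL.IsLongRunCov S X P) (hSpos : S.PosDef)
    -- the `d`-dimensional standard Brownian motion
    {Ω' : Type*} [MeasurableSpace Ω'] (P' : Measure Ω') [IsProbabilityMeasure P']
    (B : Ω' → C(I, EBEL.E d)) (hB : EBEL.IsStdBrownianVector B P')
    -- the functional central limit theorem
    (hFCLT : TendstoInDistribution
      (fun (n : ℕ) ω => (√(n : ℝ))⁻¹ • EBEL.partialSumPath (fun t => X t ω) μ₀ n)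
      atTop (fun ω' => EBEL.sqrtPath S (B ω')) (fun _ => P) P') :
    -- with probability tending to one, the ratio is positive and the multiplier is well defined
    Tendsto (fun n : ℕ =>
      P {ω | 0 < EBEL.elRatio (EBEL.blockSum w (fun t => X t ω) μ₀ n)}) atTop (𝓝 1) ∧
    Tendsto (fun n : ℕ =>
      P {ω | ∃! l, EBEL.IsMultiplier (EBEL.blockSum w (fun t => X t ω) μ₀ n) l}) atTop (𝓝 1) ∧
    ∃ Y : Ω' → EBEL.E d, Measurable Y ∧
      (∀ᵐ ω' ∂P', EBEL.IsUniqueMinimizer w (B ω') (Y ω')) ∧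
      TendstoInDistribution
        (fun (n : ℕ) ω => √(n : ℝ) • EBEL.sqrtMap S
          (EBEL.multiplier (EBEL.blockSum w (fun t => X t ω) μ₀ n)))
        atTop Y (fun _ => P) P' ∧
      TendstoInDistribution
        (fun (n : ℕ) ω => -(1 / (n : ℝ)) *
          Real.log (EBEL.elRatio (EBEL.blockSum w (fun t => X t ω) μ₀ n)))
        atTop (fun ω' => (-EBEL.limitObj w (B ω') (Y ω')).toReal) (fun _ => P) P' ∧
      (∀ᵐ ω' ∂P', 0 < -EBEL.limitObj w (B ω') (Y ω') ∧
        -EBEL.limitObj w (B ω') (Y ω') < ⊤) := by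
  have hwc : Continuous fun t : I => w t := continuousOn_iff_continuous_domRestrict.1
    hw.continuousOn
  -- the standardized paths
  obtain ⟨u, hu⟩ := isUnit_sqrtMap hSpos
  have hAinv : ∀ z, sqrtMap S ((u⁻¹ : (E d →L[ℝ] E d)ˣ).1 z) = z := fun z => by
    rw [← hu]; exact congrArg (fun f : E d →L[ℝ] E d => f z) u.mul_inv
  have hinvA : ∀ z, (u⁻¹ : (E d →L[ℝ] E d)ˣ).1 (sqrtMap S z) = z := fun z => by
    rw [← hu]; exact congrArg (fun f : E d →L[ℝ] E d => f z) u.inv_mul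
  -- Applying `Σ^{-1/2}` pointwise is continuous and turns the limit `Σ^{1/2} B` into `B`.
  set g : C(I, E d) → C(I, E d) := fun b =>
    ContinuousMap.comp ⟨_, (u⁻¹ : (E d →L[ℝ] E d)ˣ).1.continuous⟩ b with hg
  have hgc : Continuous g := ContinuousMap.continuous_postcomp _
  have hconv := hFCLT.continuous_comp hgc
  have hgB : (g ∘ fun ω' => sqrtPath S (B ω')) = B := by
    funext ω'
    ext1 t
    exact hinvA _
  rw [hgB] at hconv
  set b : ℕ → Ω → C(I, E d) := fun n =>
    g ∘ fun ω => (√(n : ℝ))⁻¹ • partialSumPath (fun t => X t ω) μ₀ n with hb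
  set L : ℕ → E d →L[ℝ] E d := fun n => √(n : ℝ) • sqrtMap S with hL
  have hLs : ∀ n x y, inner ℝ (L n x) y = inner ℝ x (L n y) := fun n x y => by
    simp only [hL, smul_apply, real_inner_smul_left, real_inner_smul_right,
      inner_sqrtMap]
  have hLb : ∀ n, 0 < n → Function.Bijective (L n) := by
    intro n hn
    have h0 : √(n : ℝ) ≠ 0 := (Real.sqrt_pos.2 (by exact_mod_cast hn)).ne'
    refine Function.bijective_iff_has_inverse.2
      ⟨fun z => (√(n : ℝ))⁻¹ • (u⁻¹ : (E d →L[ℝ] E d)ˣ).1 z, fun z => ?_, fun z => ?_⟩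
    · simp only [hL, smul_apply, map_smul, hinvA, smul_smul,
        inv_mul_cancel₀ h0, one_smul]
    · simp only [hL, smul_apply, map_smul, hAinv, smul_smul,
        inv_mul_cancel₀ h0, one_smul]
  have hblock : ∀ n ω, blockSum w (fun t => X t ω) μ₀ n
      = fun i => L n (pathBlock w (b n ω) n i) := by
    intro n ω
    funext i
    have hn : 0 < n := by rcases i with i | i <;> exact i.pos
    have h0 : √(n : ℝ) ≠ 0 := (Real.sqrt_pos.2 (by exact_mod_cast hn)).ne'
    refine blockSum_eq (fun t => ?_) i
    change √(n : ℝ) • sqrtMap S ((u⁻¹ : (E d →L[ℝ] E d)ˣ).1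
      ((√(n : ℝ))⁻¹ • partialSumPath (fun t => X t ω) μ₀ n t)) = _
    rw [hAinv, smul_smul, mul_inv_cancel₀ h0, one_smul]
  -- almost sure properties of the limit
  have hgood := ae_forall_exists_inner_neg hw hB
  -- The index `0` is discarded: there `L` is zero and the grid is empty.
  have hpos : ∀ {p : C(I, E d)}, ∀ᶠ q : ℕ × C(I, E d) in atTop ×ˢ 𝓝 p, 0 < q.1 := fun {p} =>
    (tendsto_fst (f := atTop) (g := 𝓝 p)).eventually (eventually_gt_atTop 0)
  have hex : ∀ᵐ ω' ∂P', ∀ᶠ q : ℕ × C(I, E d) in atTop ×ˢ 𝓝 (B ω'),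
      ∃! l, IsMultiplier (pathBlock w q.2 q.1) l := by
    filter_upwards [hgood] with ω' hω'
    obtain ⟨R, hR⟩ := eventually_existsUnique hwc tendsto_fst tendsto_snd hω'
    exact hR.mono fun q hq => hq.1
  classical
  -- A pointwise choice with no evident measurability. It is almost everywhere measurable as a limit
  -- of grid multipliers of `B`, and is then replaced by a measurable version.
  set Y₀ : Ω' → E d := fun ω' =>
    if h : ∃ y, IsUniqueMinimizer w (B ω') y then h.choose else 0 with hY₀
  have hY₀min : ∀ᵐ ω' ∂P', IsUniqueMinimizer w (B ω') (Y₀ ω') := by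
    filter_upwards [hgood] with ω' hω'
    have h := exists_isUniqueMinimizer hwc hω'
    simp only [hY₀, dif_pos h]
    exact h.choose_spec
  have hY₀m : AEMeasurable Y₀ P' := by
    refine aemeasurable_of_tendsto_metrizable_ae' (f := fun (n : ℕ) ω' =>
      multiplier (pathBlock w (B ω') n)) (fun n => ?_) ?_
    · exact (measurable_multiplier.comp
        ((measurable_pathBlock hwc n).comp hB.measurable)).aemeasurable
    · filter_upwards [hgood, hY₀min] with ω' h1 h2
      exact tendsto_multiplier hwc tendsto_id tendsto_const_nhds h1 h2
  have hYmin : ∀ᵐ ω' ∂P', IsUniqueMinimizer w (B ω') (hY₀m.mk Y₀ ω') := by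
    filter_upwards [hY₀min, hY₀m.ae_eq_mk] with ω' h1 h2
    rwa [← h2]
  refine ⟨?_, ?_, hY₀m.mk Y₀, hY₀m.measurable_mk, hYmin, ?_, ?_, ?_⟩
  · simp only [hblock]
    refine tendsto_measure_one_of_eventually hconv
      (D := fun n => {p | 0 < elRatio fun i => L n (pathBlock w p n i)}) ?_
    filter_upwards [hex] with ω' hω'
    filter_upwards [hω', hpos] with q hq hq0
    have : Nonempty (Fin q.1 ⊕ Fin q.1) := ⟨Sum.inl ⟨0, hq0⟩⟩
    change 0 < elRatio fun i => L q.1 (pathBlock w q.2 q.1 i)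
    rw [elRatio_comp (hLb q.1 hq0).1]
    exact (isMultiplier_multiplier hq).elRatio_pos
  · simp only [hblock]
    refine tendsto_measure_one_of_eventually hconv
      (D := fun n => {p | ∃! l, IsMultiplier (fun i => L n (pathBlock w p n i)) l}) ?_
    filter_upwards [hex] with ω' hω'
    filter_upwards [hω', hpos] with q hq hq0
    exact (existsUnique_isMultiplier_comp_iff (hLs q.1) (hLb q.1 hq0)).2 hq
  · have hm : ∀ n, AEMeasurable (fun ω => L n (multiplier
        (blockSum w (fun t => X t ω) μ₀ n))) P := fun n =>
      ((L n).continuous.measurable.comp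
        (measurable_multiplier.comp (measurable_blockSum hX.measurable w μ₀ n))).aemeasurable
    change TendstoInDistribution (fun (n : ℕ) ω => L n (multiplier
        (blockSum w (fun t => X t ω) μ₀ n))) _ _ _ _
    simp only [hblock] at hm ⊢
    refine tendstoInDistribution_map hconv
      (Φ := fun n p => L n (multiplier fun i => L n (pathBlock w p n i))) hm
      hY₀m.measurable_mk.aemeasurable ?_
    filter_upwards [hgood, hYmin] with ω' h1 h2
    refine (tendsto_multiplier hwc tendsto_fst tendsto_snd h1 h2).congr' ?_
    filter_upwards [hpos] with q hq0
    exact (multiplier_comp (hLs q.1) (hLb q.1 hq0)).symm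
  · have hm : ∀ n : ℕ, AEMeasurable (fun ω => -(1 / (n : ℝ)) * Real.log (elRatio
        (blockSum w (fun t => X t ω) μ₀ n))) P := fun n =>
      ((measurable_elRatio.comp
        (measurable_blockSum hX.measurable w μ₀ n)).log.const_mul _).aemeasurable
    simp only [hblock] at hm ⊢
    -- Measurability of the limit value again comes from its approximation by grid values.
    have hV : AEMeasurable (fun ω' => (-limitObj w (B ω') (hY₀m.mk Y₀ ω')).toReal) P' := by
      refine aemeasurable_of_tendsto_metrizable_ae' (f := fun (n : ℕ) ω' =>
        gridVal w (B ω') n (multiplier (pathBlock w (B ω') n)))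
        (fun n => ((measurable_gridVal hwc n).comp hB.measurable).aemeasurable) ?_
      filter_upwards [hgood, hYmin] with ω' h1 h2
      exact tendsto_gridVal hwc tendsto_id tendsto_const_nhds h1 h2
    refine tendstoInDistribution_map hconv
      (Φ := fun n p => -(1 / (n : ℝ)) * Real.log (elRatio fun i => L n (pathBlock w p n i))) hm
      hV ?_
    filter_upwards [hgood, hYmin, hex] with ω' h1 h2 h3
    refine (tendsto_gridVal hwc tendsto_fst tendsto_snd h1 h2).congr' ?_
    filter_upwards [h3, hpos] with q hq hq0
    have : Nonempty (Fin q.1 ⊕ Fin q.1) := ⟨Sum.inl ⟨0, hq0⟩⟩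
    rw [elRatio_comp (hLb q.1 hq0).1, (isMultiplier_multiplier hq).log_elRatio_eq, gridVal]
    ring
  · filter_upwards [hYmin, ae_exists_direction hd hw hwc hB] with ω' h1 ⟨v, hv⟩
    refine ⟨by simpa using h1.neg hwc hv, ?_⟩
    rw [lt_top_iff_ne_top, Ne, EReal.neg_eq_top_iff]
    exact limitObj_ne_bot hwc
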